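/- Let $H=\sum_a H_a$ be a $k$-local Hamiltonian on $n$ qubits: each $H_a$ is Hermitian with $\|H_a\|\le 1$ and acts nontrivially on at most $k$ qubits. Suppose that $H$ has a non-degenerate ground state $\psi$ (normalized) and spectral gap $\gamma>0$ (the difference between its second-smallest and its smallest eigenvalue). Let $\pi(x)=|\langle x|\psi\rangle|^2$, assume that $\pi(x)>0$ for all $x\in\{0,1\}^n$, and put $\pi^*=\min_x\pi(x)$. Consider the continuous-time Markov chain on $\{0,1\}^n$ whose transition rate from $x$ to $y\neq x$ is \[ \langle y|G|x\rangle=\max\Big\{0,\,-\mathrm{Re}\Big(\langle y|H|x\rangle\,\overline{\langle y|\psi\rangle/\langle x|\psi\rangle}\Big)\Big\},\qquad |\langle x|G|x\rangle|=\sum_{y\ne x}\langle y|G|x\rangle ; \] if $H$ has real matrix elements, the rate is $\max\{0,-\langle y|H|x\rangle\langle y|\psi\rangle/\langle x|\psi\rangle\}$. The amplitude computation subroutine returns $\langle y|\psi\rangle/\langle x|\psi\rangle$ on input $x,y$. For fixed $H$, $k$, $\gamma$ and $\pi^*$, the following classical randomized algorithm takes as input a precision $0<\epsilon\le 1$ and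 a starting state $x_{in}\in\{0,1\}^n$, and accesses $\psi$ only through the subroutine. It simulates the chain, started at $x_{in}$, by Gillespie's algorithm (in state $x$, compute the rates by calling the subroutine for every $y\ne x$ with $\langle y|H|x\rangle\neq0$, wait for a time $\log(1/u)/|\langle x|G|x\rangle|$ with $u$ uniform in $[0,1]$, return $x$ if the elapsed time is at least $t$, and otherwise jump to $y$ with probability $\langle y|G|x\rangle/|\langle x|G|x\rangle|$) for the evolution time $t=\gamma^{-1}\log\big(2/(\epsilon\sqrt{\pi^*})\big)$, and declares an error if the number of jumps exceeds $4\epsilon^{-1}t\,n^k\|H\|$. There is a universal constant $C>0$ such that, for all such $n,k,H,\psi,\gamma,\epsilon$: (1) for every starting state, the algorithm outputs a bit string or declares an error (the probabilities of these outcomes add up to one), and in the worst case over its random choices it makes at most \[ T=\frac{C\,\epsilon^{-1}n^{2k}\|H\|}{\gamma}\,\log\Big(\frac1{\epsilon\pi^*}\Big) \] calls to the amplitude computation subroutine; (2) the set $S_\epsilon\subseteq\{0,1\}^n$ of the starting states for which the algorithm declares an error with probability at most $\epsilon/4$ is nonempty; (3) if $x_{in}\in S_\epsilon$, then the distribution of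 the output, conditioned on no error, is $\epsilon$-close to $\pi$ in total variation distance. -/

import Mathlib

open scoped ENNReal Matrix

namespace GroundStateSampling

/-- Bit strings of length `n`, labelling the standard basis of `n` qubits. -/
abbrev Bits (n : ℕ) : Type := Fin n → Bool

/-- Operators on `n` qubits, as matrices in the standard basis; `A x y` is `⟨x|A|y⟩`. -/
abbrev Op (n : ℕ) : Type := Matrix (Bits n) (Bits n) ℂ

/-- The operator norm (largest singular value) of an `n`-qubit operator. -/
noncomputable def opNorm {n : ℕ} (A : Op n) : ℝ :=
  ‖Matrix.toEuclideanCLM (n := Bits n) (𝕜 := ℂ) A‖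

/-- `A` acts nontrivially only on the qubits in `S`: it is `B ⊗ I` for an operator `B`
on the qubits in `S` and the identity `I` on the other qubits. -/
def ActsOn {n : ℕ} (A : Op n) (S : Finset (Fin n)) : Prop :=
  ∃ B : Matrix (S → Bool) (S → Bool) ℂ, ∀ x y : Bits n,
    ((∀ i, i ∉ S → x i = y i) → A x y = B (fun i => x i) (fun i => y i)) ∧
    ((∃ i, i ∉ S ∧ x i ≠ y i) → A x y = 0)

/-- `H` is a `k`-local Hamiltonian: a finite sum of Hermitian terms of norm at most one,
each acting nontrivially on at most `k` qubits. -/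
def IsLocalHamiltonian {n : ℕ} (k : ℕ) (H : Op n) : Prop :=
  ∃ (m : ℕ) (h : Fin m → Op n), H = ∑ a, h a ∧
    ∀ a, (h a).IsHermitian ∧ opNorm (h a) ≤ 1 ∧
      ∃ S : Finset (Fin n), S.card ≤ k ∧ ActsOn (h a) S

/-- `ψ` is the normalized, non-degenerate ground state of the Hermitian operator `H`, and `H`
has spectral gap `γ > 0`: `ψ` has some eigenvalue `E`, and the smallest eigenvalue of `H` on
the orthogonal complement of `ψ` is `E + γ`. -/
def IsGroundState {n : ℕ} (H : Op n) (ψ : Bits n → ℂ) (γ : ℝ) : Prop :=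
  ∑ x, ‖ψ x‖ ^ 2 = 1 ∧ 0 < γ ∧
    ∃ E : ℝ, H *ᵥ ψ = (E : ℂ) • ψ ∧
      IsLeast {μ : ℝ | ∃ φ : Bits n → ℂ, φ ≠ 0 ∧ star ψ ⬝ᵥ φ = 0 ∧ H *ᵥ φ = (μ : ℂ) • φ} (E + γ)

/-- The ground state distribution `π(x) = |⟨x|ψ⟩|²`. -/
noncomputable def groundDist {n : ℕ} (ψ : Bits n → ℂ) (x : Bits n) : ℝ := ‖ψ x‖ ^ 2

/-- `π* = min_x π(x)`. -/
noncomputable def minProb {n : ℕ} (ψ : Bits n → ℂ) : ℝ := ⨅ x, groundDist ψ x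

/-- Total variation distance of two distributions on a finite set. -/
noncomputable def tvDist {X : Type} [Fintype X] (p q : X → ℝ) : ℝ := (∑ x, |p x - q x|) / 2

/-- Classical randomized programs with output in `A` that may call a subroutine which takes two
elements of `X` and returns a complex number. A program may
* stop with an output,
* call the subroutine on `x`, `y` and continue depending on the answer,
* draw a uniform number in `[0,1]` and continue depending on it,
* draw an element of `X` from a probability distribution and continue depending on it. -/
inductive Prog (X A : Type) : Type
  | ret (a : A) : Prog X A
  | query (x y : X) (next : ℂ → Prog X A) : Prog X A
  | uniform (next : ℝ → Prog X A) : Prog X A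
  | draw (p : PMF X) (next : X → Prog X A) : Prog X A

/-- The probability that a program outputs `b`, when its subroutine calls are answered by `O`. -/
noncomputable def Prog.prob {X A : Type} (O : X → X → ℂ) : Prog X A → A → ℝ≥0∞
  | .ret a => Set.indicator {a} 1
  | .query x y next => (next (O x y)).prob O
  | .uniform next => fun b => ∫⁻ u in Set.Icc (0 : ℝ) 1, (next u).prob O b
  | .draw p next => fun b => ∑' y, p y * (next y).prob O b

/-- The number of subroutine calls that a program makes in the worst case over all its random
choices, when the calls are answered by `O`. -/
noncomputable def Prog.maxCalls {X A : Type} (O : X → X → ℂ) : Prog X A → ℕ∞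
  | .ret _ => 0
  | .query x y next => 1 + (next (O x y)).maxCalls O
  | .uniform next => ⨆ u : Set.Icc (0 : ℝ) 1, (next u).maxCalls O
  | .draw _ next => ⨆ y, (next y).maxCalls O

/-- The amplitude computation subroutine `x, y ⟶ ⟨y|ψ⟩ / ⟨x|ψ⟩`. -/
noncomputable def amplitudeRatio {n : ℕ} (ψ : Bits n → ℂ) (x y : Bits n) : ℂ := ψ y / ψ x

open Classical in
/-- Call the subroutine on `(x, y)` for every `y` in a list, and continue with the table of
answers (zero outside of the list). -/
noncomputable def askAll {X A : Type} (x : X) : List X → ((X → ℂ) → Prog X A) → Prog X A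
  | [], next => next 0
  | y :: l, next => .query x y fun r => askAll x l fun f => next (Function.update f y r)

open Classical in
/-- The `y ≠ x` with `⟨y|H|x⟩ ≠ 0`. -/
noncomputable def neighbors {n : ℕ} (H : Op n) (x : Bits n) : Finset (Bits n) :=
  Finset.univ.filter fun y => y ≠ x ∧ H y x ≠ 0

/-- The transition rate `⟨y|G|x⟩` from `x` to `y`, computed from the ratio
`r y = ⟨y|ψ⟩ / ⟨x|ψ⟩`. If `H` has real matrix elements then its non-degenerate ground state has
real ratios, and this is `max {0, - ⟨y|H|x⟩ ⟨y|ψ⟩ / ⟨x|ψ⟩}`. The conjugate and the real part make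
the rate independent of the phases of the basis vectors when `H` has complex matrix elements. -/
noncomputable def jumpRate {n : ℕ} (H : Op n) (x : Bits n) (r : Bits n → ℂ) (y : Bits n) : ℝ :=
  if y = x then 0 else max 0 (-(H y x * star (r y)).re)

lemma jumpRate_nonneg {n : ℕ} (H : Op n) (x : Bits n) (r : Bits n → ℂ) (y : Bits n) :
    0 ≤ jumpRate H x r y := by
  unfold jumpRate
  split_ifs
  · exact le_rfl
  · exact le_max_left _ _

/-- The total rate `|⟨x|G|x⟩|` of leaving `x`. -/
noncomputable def exitRate {n : ℕ} (H : Op n) (x : Bits n) (r : Bits n → ℂ) : ℝ :=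
  ∑ y, jumpRate H x r y

/-- The distribution `⟨y|G|x⟩ / |⟨x|G|x⟩|` of the next state `y`. -/
noncomputable def jumpLaw {n : ℕ} (H : Op n) (x : Bits n) (r : Bits n → ℂ)
    (h : exitRate H x r ≠ 0) : PMF (Bits n) :=
  PMF.normalize (fun y => ENNReal.ofReal (jumpRate H x r y))
    (by
      rw [tsum_fintype, ← ENNReal.ofReal_sum_of_nonneg fun y _ => jumpRate_nonneg H x r y]
      have h0 : 0 ≤ exitRate H x r := Finset.sum_nonneg fun y _ => jumpRate_nonneg H x r y
      exact (ENNReal.ofReal_pos.2 (lt_of_le_of_ne h0 (Ne.symm h))).ne')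
    (by
      rw [tsum_fintype]
      exact ENNReal.sum_ne_top.2 fun y _ => ENNReal.ofReal_ne_top)

open Classical in
/-- One iteration of Gillespie's algorithm in state `x` at time `τ`, with evolution time `t`:
compute the rates, draw the waiting time `log (1/u) / |⟨x|G|x⟩|`, return `x` if the evolution time
is reached (always, if the rate of leaving `x` is zero), and otherwise draw the next state and
continue with the new time and state. -/
noncomputable def gillespieStep {n : ℕ} (H : Op n) (t τ : ℝ) (x : Bits n)
    (next : ℝ → Bits n → Prog (Bits n) (Option (Bits n))) : Prog (Bits n) (Option (Bits n)) :=
  askAll x (neighbors H x).toList fun r =>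
    if h : exitRate H x r = 0 then .ret (some x)
    else .uniform fun u =>
      if t ≤ τ + Real.log (1 / u) / exitRate H x r then .ret (some x)
      else .draw (jumpLaw H x r h) fun y => next (τ + Real.log (1 / u) / exitRate H x r) y

/-- Gillespie's algorithm with evolution time `t`, started in a given state at a given time, and
truncated: it outputs a string if it makes at most `M` flips, and declares an error (`none`) when
the number of flips exceeds `M`. -/
noncomputable def truncatedGillespie {n : ℕ} (H : Op n) (t : ℝ) :
    ℕ → ℝ → Bits n → Prog (Bits n) (Option (Bits n))
  | 0 => fun τ x => gillespieStep H t τ x fun _ _ => .ret none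
  | M + 1 => fun τ x => gillespieStep H t τ x (truncatedGillespie H t M)

/-- The evolution time `γ⁻¹ log (2 / (ε √π*))`. -/
noncomputable def evolutionTime (γ pmin ε : ℝ) : ℝ := Real.log (2 / (ε * √pmin)) / γ

/-- The cutoff `4 ε⁻¹ t n^k ‖H‖` on the number of flips. -/
noncomputable def flipCutoff {n : ℕ} (k : ℕ) (H : Op n) (ε t : ℝ) : ℝ :=
  4 * ε⁻¹ * t * (n : ℝ) ^ k * opNorm H

/-- The sampling algorithm for a `k`-local Hamiltonian `H` with spectral gap `γ` and minimal ground
state probability `pmin`, on input of a precision `ε` and a starting state `x`. It accesses the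
ground state only through the subroutine. -/
noncomputable def sampler {n : ℕ} (k : ℕ) (H : Op n) (γ pmin : ℝ) (ε : ℝ) (x : Bits n) :
    Prog (Bits n) (Option (Bits n)) :=
  truncatedGillespie H (evolutionTime γ pmin ε)
    ⌊flipCutoff k H ε (evolutionTime γ pmin ε)⌋₊ 0 x

/-- The distribution of the output of a program, conditioned on no error. -/
noncomputable def condOutput {X : Type} (O : X → X → ℂ) (p : Prog X (Option X)) (y : X) : ℝ :=
  (p.prob O (some y) / ∑' z, p.prob O (some z)).toReal

/-- The set `S_ε` of the starting states for which the algorithm `alg` declares an error with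
probability at most `ε / 4`. -/
def goodStarts {X : Type} (O : X → X → ℂ) (alg : X → Prog X (Option X)) (ε : ℝ) : Set X :=
  {x | (alg x).prob O none ≤ ENNReal.ofReal (ε / 4)}

end GroundStateSampling

namespace GroundStateSampling

/-! The chain is reversible for `π`: the flow `π(x) q(x,y)` is the positive part of `-A(x,y)`, where
`A(x,y) = Re(conj ψ(y) H(y,x) ψ(x))` is symmetric because `H` is Hermitian. If `f` has `π`-mean
zero, the vector `fψ` is orthogonal to `ψ`, and the eigenvalue equation gives `⟨fψ|(H - E)|fψ⟩ =
-(1/2) ∑ A(x,y) (f x - f y)²`. Replacing `-A` by its positive part off the diagonal only increases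
the right side, so the gap of `H` yields a Poincaré inequality with constant `γ`
(`IsGroundState.poincare`). Variances therefore decay like `exp (-2γs)`, and at the chosen time the
law started at any `x` is within `ε/4` of `π` (`semigroup_single_mixing`).

The recursive program is compared with the chain without constructing a path space. The semigroup
and the expected number of jumps both satisfy a first jump identity (`lintegral_waiting_time`), and
induction on the cutoff gives two inequalities: the program outputs `y` with at most the transition
probability (`prob_some_le_semigroup`), and `M + 1` times its error probability is at most the
expected number of jumps (`prob_none_le_expectedJumps`).

In stationarity the mean jump rate is at most `n^k ‖H‖`, since each string has at most `n^k`
neighbors. Hence the `π`-average of the error probability is below `ε/4`, and some start is good.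
From a good start, conditioning costs at most `ε/4` on top of the mixing error. The number of calls
is at most `n^k` per iteration. -/

open MeasureTheory Set

/-! ### Transition semigroup and expected jump count of a finite chain -/

section Chain

variable {X : Type*} [Fintype X]

/-- The generator `(L f)(x) = ∑ z, q x z (f z - f x)` of the continuous-time Markov chain with
transition rates `q`, acting on functions. -/
noncomputable def generator (q : X → X → ℝ) : (X → ℝ) →L[ℝ] (X → ℝ) :=
  LinearMap.toContinuousLinearMap
    { toFun := fun f x => ∑ z, q x z * (f z - f x)
      map_add' := fun f g => by
        ext x
        simp only [Pi.add_apply, ← Finset.sum_add_distrib]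
        exact Finset.sum_congr rfl fun z _ => by ring
      map_smul' := fun c f => by
        ext x
        simp only [Pi.smul_apply, smul_eq_mul, RingHom.id_apply, Finset.mul_sum]
        exact Finset.sum_congr rfl fun z _ => by ring }

lemma generator_apply (q : X → X → ℝ) (f : X → ℝ) (x : X) :
    generator q f x = ∑ z, q x z * (f z - f x) := rfl

lemma generator_apply_eq (q : X → X → ℝ) (f : X → ℝ) (x : X) :
    generator q f x = ∑ z, q x z * f z - (∑ z, q x z) * f x := by
  simp only [generator_apply, mul_sub, Finset.sum_sub_distrib, Finset.sum_mul]

/-- A uniform bound for the exit rates. -/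
noncomputable def totalRate (q : X → X → ℝ) : ℝ := ∑ x, ∑ z, q x z

lemma exit_le_totalRate {q : X → X → ℝ} (hq : ∀ x y, 0 ≤ q x y) (x : X) :
    ∑ z, q x z ≤ totalRate q :=
  Finset.single_le_sum (f := fun x => ∑ z, q x z)
    (fun y _ => Finset.sum_nonneg fun z _ => hq y z) (Finset.mem_univ x)

/-- The transition semigroup `exp (s L)`, written with the positivity preserving operator
`L + c` for a bound `c` of the exit rates. -/
noncomputable def semigroup (q : X → X → ℝ) (s : ℝ) : (X → ℝ) →L[ℝ] (X → ℝ) :=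
  Real.exp (-(totalRate q * s)) •
    NormedSpace.exp (s • (generator q + totalRate q • (1 : (X → ℝ) →L[ℝ] (X → ℝ))))

lemma semigroup_zero (q : X → X → ℝ) : semigroup q 0 = 1 := by
  simp [semigroup]

lemma hasDerivAt_semigroup (q : X → X → ℝ) (f : X → ℝ) (s : ℝ) :
    HasDerivAt (fun s => semigroup q s f) (generator q (semigroup q s f)) s := by
  set A := generator q + totalRate q • (1 : (X → ℝ) →L[ℝ] (X → ℝ)) with hA
  have h1 : HasDerivAt (fun s : ℝ => Real.exp (-(totalRate q * s)))
      (Real.exp (-(totalRate q * s)) * (-(totalRate q * 1))) s :=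
    (((hasDerivAt_id s).const_mul (totalRate q)).neg).exp
  have h2 := (hasDerivAt_exp_smul_const' (𝕂 := ℝ) A s).clm_apply (hasDerivAt_const s f)
  have h3 := h1.smul h2
  refine h3.congr_deriv ?_
  simp only [semigroup, ← hA, ContinuousLinearMap.map_zero, add_zero,
    mul_apply_eq_comp, smul_apply, map_smul]
  set g := (NormedSpace.exp (s • A)) f
  have : A g = generator q g + totalRate q • g := by simp [hA]
  rw [this]
  module

lemma hasDerivAt_semigroup_apply (q : X → X → ℝ) (f : X → ℝ) (x : X) (s : ℝ) :
    HasDerivAt (fun s => semigroup q s f x) (generator q (semigroup q s f) x) s :=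
  hasDerivAt_pi.1 (hasDerivAt_semigroup q f s) x

lemma continuous_semigroup (q : X → X → ℝ) (f : X → ℝ) :
    Continuous fun s => semigroup q s f :=
  continuous_iff_continuousAt.2 fun s => (hasDerivAt_semigroup q f s).continuousAt

lemma continuous_semigroup_apply (q : X → X → ℝ) (f : X → ℝ) (x : X) :
    Continuous fun s => semigroup q s f x :=
  (continuous_apply x).comp (continuous_semigroup q f)

/-- The shifted generator has nonnegative matrix entries, because the shift dominates every exit
rate. So each term of the exponential series preserves nonnegativity. -/
lemma semigroup_nonneg {q : X → X → ℝ} (hq : ∀ x y, 0 ≤ q x y) {f : X → ℝ} (hf : 0 ≤ f)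
    {s : ℝ} (hs : 0 ≤ s) : 0 ≤ semigroup q s f := by
  set A := generator q + totalRate q • (1 : (X → ℝ) →L[ℝ] (X → ℝ)) with hA
  have hAn : ∀ g : X → ℝ, 0 ≤ g → 0 ≤ A g := by
    intro g hg x
    have : A g x = ∑ z, q x z * g z + (totalRate q - ∑ z, q x z) * g x := by
      simp only [hA, add_apply, smul_apply,
        one_apply_eq_self, Pi.add_apply, Pi.smul_apply, smul_eq_mul,
        generator_apply_eq]
      ring
    rw [this]
    exact add_nonneg (Finset.sum_nonneg fun z _ => mul_nonneg (hq x z) (hg z))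
      (mul_nonneg (sub_nonneg.2 (exit_le_totalRate hq x)) (hg x))
  have hpow : ∀ n : ℕ, 0 ≤ ((s • A) ^ n) f := by
    intro n
    induction n with
    | zero => simpa using hf
    | succ n ih =>
      rw [pow_succ', mul_apply_eq_comp, smul_apply]
      exact smul_nonneg hs (hAn _ ih)
  have hsum := (NormedSpace.exp_series_hasSum_exp' (𝕂 := ℝ) (s • A)).mapL
    (ContinuousLinearMap.apply ℝ (X → ℝ) f)
  have hnn : 0 ≤ NormedSpace.exp (s • A) f := by
    refine hsum.nonneg fun n => ?_
    simp only [ContinuousLinearMap.apply_apply, smul_apply]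
    exact smul_nonneg (by positivity) (hpow n)
  exact smul_nonneg (Real.exp_pos _).le hnn

/-- The expected number of jumps up to time `s`, as a function of the starting state. -/
noncomputable def expectedJumps (q : X → X → ℝ) (s : ℝ) : X → ℝ :=
  ∫ r in (0 : ℝ)..s, semigroup q r (fun x => ∑ z, q x z)

lemma expectedJumps_zero (q : X → X → ℝ) : expectedJumps q 0 = 0 := by
  simp [expectedJumps]

/-- Integrating the backward equation from `0` to `s` turns the plain derivative `semigroup q s e`
into an inhomogeneous backward equation, the form needed for a first jump identity. -/
lemma hasDerivAt_expectedJumps (q : X → X → ℝ) (s : ℝ) :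
    HasDerivAt (expectedJumps q)
      (generator q (expectedJumps q s) + fun x => ∑ z, q x z) s := by
  set e : X → ℝ := fun x => ∑ z, q x z
  have hc := continuous_semigroup q e
  have h1 : HasDerivAt (expectedJumps q) (semigroup q s e) s :=
    intervalIntegral.integral_hasDerivAt_right (hc.intervalIntegrable _ _)
      (hc.stronglyMeasurableAtFilter _ _) hc.continuousAt
  have h2 : generator q (expectedJumps q s) = semigroup q s e - e := by
    rw [expectedJumps, ← ContinuousLinearMap.intervalIntegral_comp_comm _
      (hc.intervalIntegrable _ _)]
    rw [intervalIntegral.integral_eq_sub_of_hasDerivAt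
      (f := fun r => semigroup q r e) (fun r _ => hasDerivAt_semigroup q e r)
      (((generator q).continuous.comp hc).intervalIntegrable _ _)]
    simp [semigroup_zero]
  rw [h2]
  simpa using h1

lemma hasDerivAt_expectedJumps_apply (q : X → X → ℝ) (x : X) (s : ℝ) :
    HasDerivAt (fun s => expectedJumps q s x)
      (generator q (expectedJumps q s) x + ∑ z, q x z) s :=
  hasDerivAt_pi.1 (hasDerivAt_expectedJumps q s) x

lemma continuous_expectedJumps_apply (q : X → X → ℝ) (x : X) :
    Continuous fun s => expectedJumps q s x :=
  continuous_iff_continuousAt.2 fun s => (hasDerivAt_expectedJumps_apply q x s).continuousAt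

lemma expectedJumps_nonneg {q : X → X → ℝ} (hq : ∀ x y, 0 ≤ q x y) {s : ℝ} (hs : 0 ≤ s) :
    0 ≤ expectedJumps q s := by
  intro x
  have hc := continuous_semigroup q (fun x => ∑ z, q x z)
  have h := ContinuousLinearMap.intervalIntegral_comp_comm
    (ContinuousLinearMap.proj (R := ℝ) (φ := fun _ : X => ℝ) x)
    (hc.intervalIntegrable (μ := volume) 0 s)
  change 0 ≤ ContinuousLinearMap.proj (R := ℝ) (φ := fun _ : X => ℝ) x (expectedJumps q s)
  rw [expectedJumps, ← h]
  exact intervalIntegral.integral_nonneg hs fun r hr =>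
    semigroup_nonneg hq (fun x => Finset.sum_nonneg fun z _ => hq x z) hr.1 x

/-! ### Reversible chains: stationarity, variance decay, pointwise convergence -/

section Reversible

variable {q : X → X → ℝ} {w : X → ℝ}

lemma sum_mul_generator_eq_zero (hrev : ∀ x y, w x * q x y = w y * q y x) (f : X → ℝ) :
    ∑ x, w x * generator q f x = 0 := by
  have h : ∑ x, w x * generator q f x = ∑ x, ∑ y, (w x * q x y * f y - w x * q x y * f x) := by
    refine Finset.sum_congr rfl fun x _ => ?_
    rw [generator_apply, Finset.mul_sum]
    exact Finset.sum_congr rfl fun y _ => by ring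
  rw [h]
  simp only [Finset.sum_sub_distrib]
  rw [sub_eq_zero, Finset.sum_comm]
  exact Finset.sum_congr rfl fun x _ => Finset.sum_congr rfl fun y _ => by rw [hrev]

/-- The Dirichlet form of a reversible chain. -/
lemma sum_mul_generator_eq_neg_dirichlet (hrev : ∀ x y, w x * q x y = w y * q y x)
    (f : X → ℝ) :
    ∑ x, w x * (f x * generator q f x) =
      -((∑ x, ∑ y, w x * q x y * (f x - f y) ^ 2) / 2) := by
  have h : ∑ x, w x * (f x * generator q f x) =
      ∑ x, ∑ y, w x * q x y * (f x * (f y - f x)) := by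
    refine Finset.sum_congr rfl fun x _ => ?_
    rw [generator_apply, Finset.mul_sum, Finset.mul_sum]
    exact Finset.sum_congr rfl fun y _ => by ring
  have h' : ∑ x, ∑ y, w x * q x y * (f x * (f y - f x)) =
      ∑ x, ∑ y, w x * q x y * (f y * (f x - f y)) := by
    rw [Finset.sum_comm]
    exact Finset.sum_congr rfl fun x _ => Finset.sum_congr rfl fun y _ => by rw [hrev]
  have h2 : ∑ x, ∑ y, w x * q x y * (f x * (f y - f x)) +
      ∑ x, ∑ y, w x * q x y * (f y * (f x - f y)) =
      -∑ x, ∑ y, w x * q x y * (f x - f y) ^ 2 := by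
    simp only [← Finset.sum_add_distrib, ← Finset.sum_neg_distrib]
    exact Finset.sum_congr rfl fun x _ => Finset.sum_congr rfl fun y _ => by ring
  rw [h]
  linarith

lemma sum_mul_semigroup (hrev : ∀ x y, w x * q x y = w y * q y x) (f : X → ℝ) (s : ℝ) :
    ∑ x, w x * semigroup q s f x = ∑ x, w x * f x := by
  have hd : ∀ s, HasDerivAt (fun s => ∑ x, w x * semigroup q s f x) 0 s := by
    intro s
    refine (HasDerivAt.fun_sum fun x _ =>
      (hasDerivAt_semigroup_apply q f x s).const_mul (w x)).congr_deriv ?_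
    exact sum_mul_generator_eq_zero hrev _
  have := is_const_of_deriv_eq_zero (fun s => (hd s).differentiableAt) (fun s => (hd s).deriv) s 0
  simpa [semigroup_zero] using this

/-- Under the stationary weights the mean jump rate does not change with time, so expected jumps
accumulate linearly. -/
lemma sum_mul_expectedJumps (hrev : ∀ x y, w x * q x y = w y * q y x) (s : ℝ) :
    ∑ x, w x * expectedJumps q s x = s * ∑ x, w x * ∑ z, q x z := by
  have hd : ∀ s, HasDerivAt (fun s => ∑ x, w x * expectedJumps q s x -
      s * ∑ x, w x * ∑ z, q x z) 0 s := by
    intro s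
    refine ((HasDerivAt.fun_sum fun x _ =>
      (hasDerivAt_expectedJumps_apply q x s).const_mul (w x)).sub
        ((hasDerivAt_id s).mul_const _)).congr_deriv ?_
    simp only [mul_add, Finset.sum_add_distrib, sum_mul_generator_eq_zero hrev]
    ring
  have := is_const_of_deriv_eq_zero (fun s => (hd s).differentiableAt) (fun s => (hd s).deriv) s 0
  simp [expectedJumps_zero] at this
  linarith

/-- Exponential decay of the variance under a Poincaré inequality. -/
lemma variance_semigroup_le {γ : ℝ} (hrev : ∀ x y, w x * q x y = w y * q y x)
    (hw1 : ∑ x, w x = 1)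
    (hgap : ∀ f : X → ℝ, ∑ x, w x * f x = 0 →
      γ * ∑ x, w x * f x ^ 2 ≤ (∑ x, ∑ y, w x * q x y * (f x - f y) ^ 2) / 2)
    (f : X → ℝ) {s : ℝ} (hs : 0 ≤ s) :
    ∑ x, w x * (semigroup q s f x - ∑ y, w y * f y) ^ 2 ≤
      Real.exp (-(2 * γ * s)) * ∑ x, w x * (f x - ∑ y, w y * f y) ^ 2 := by
  set m := ∑ y, w y * f y with hm
  let v : ℝ → X → ℝ := fun s x => semigroup q s f x - m
  have hv0 : ∀ s, ∑ x, w x * v s x = 0 := by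
    intro s
    simp only [v, mul_sub, Finset.sum_sub_distrib, ← Finset.sum_mul, hw1, sum_mul_semigroup hrev]
    rw [← hm]; ring
  have hgen : ∀ s, generator q (semigroup q s f) = generator q (v s) := by
    intro s
    ext x
    simp only [generator_apply, v]
    exact Finset.sum_congr rfl fun y _ => by ring
  have hv : ∀ s x, HasDerivAt (fun s => v s x) (generator q (v s) x) s := by
    intro s x
    rw [← hgen]
    exact (hasDerivAt_semigroup_apply q f x s).sub_const m
  have hV : ∀ s, HasDerivAt (fun s => ∑ x, w x * v s x ^ 2)
      (2 * ∑ x, w x * (v s x * generator q (v s) x)) s := by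
    intro s
    refine (HasDerivAt.fun_sum fun x _ => ((hv s x).pow 2).const_mul (w x)).congr_deriv ?_
    rw [Finset.mul_sum]
    exact Finset.sum_congr rfl fun x _ => by push_cast; ring
  -- The Poincaré inequality, applied to the centered function, says exactly that `exp (2γs)` times
  -- the variance is nonincreasing.
  have hE : ∀ s, HasDerivAt (fun s => Real.exp (2 * γ * s) * ∑ x, w x * v s x ^ 2)
      (Real.exp (2 * γ * s) * (2 * (γ * ∑ x, w x * v s x ^ 2 +
        ∑ x, w x * (v s x * generator q (v s) x)))) s := by
    intro s
    have h1 : HasDerivAt (fun s : ℝ => Real.exp (2 * γ * s))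
      (Real.exp (2 * γ * s) * (2 * γ * 1)) s := ((hasDerivAt_id s).const_mul (2 * γ)).exp
    exact (h1.mul (hV s)).congr_deriv (by ring)
  have hanti := antitone_of_hasDerivAt_nonpos hE fun s => by
    have h1 := hgap (v s) (hv0 s)
    have h2 := sum_mul_generator_eq_neg_dirichlet hrev (v s)
    exact mul_nonpos_of_nonneg_of_nonpos (Real.exp_pos _).le (by linarith)
  have h := hanti hs
  simp only [mul_zero, Real.exp_zero, one_mul, v, semigroup_zero,
    one_apply_eq_self] at h
  rw [Real.exp_neg, ← div_eq_inv_mul, le_div_iff₀ (Real.exp_pos _), mul_comm]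
  exact h

/-- Pointwise convergence of a reversible chain with a Poincaré inequality. -/
lemma abs_semigroup_sub_le {γ : ℝ} (hrev : ∀ x y, w x * q x y = w y * q y x)
    (hw : ∀ x, 0 < w x) (hw1 : ∑ x, w x = 1)
    (hgap : ∀ f : X → ℝ, ∑ x, w x * f x = 0 →
      γ * ∑ x, w x * f x ^ 2 ≤ (∑ x, ∑ y, w x * q x y * (f x - f y) ^ 2) / 2)
    {f : X → ℝ} (hf : ∀ x, |f x| ≤ 1) {s : ℝ} (hs : 0 ≤ s) (x : X) :
    |semigroup q s f x - ∑ y, w y * f y| ≤ Real.exp (-(γ * s)) / √(w x) := by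
  set m := ∑ y, w y * f y with hm
  have h := variance_semigroup_le hrev hw1 hgap f hs
  rw [← hm] at h
  have h1 : ∑ x, w x * (f x - m) ^ 2 ≤ 1 := by
    have e1 : ∑ x, w x * (f x - m) ^ 2 = ∑ x, w x * f x ^ 2 - m ^ 2 := by
      have : ∑ x, w x * (f x - m) ^ 2 =
          ∑ x, w x * f x ^ 2 - 2 * m * ∑ x, w x * f x + m ^ 2 * ∑ x, w x := by
        simp only [Finset.mul_sum, ← Finset.sum_sub_distrib, ← Finset.sum_add_distrib]
        exact Finset.sum_congr rfl fun x _ => by ring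
      rw [this, hw1, ← hm]; ring
    have e2 : ∑ x, w x * f x ^ 2 ≤ ∑ x, w x := by
      refine Finset.sum_le_sum fun x _ => ?_
      have : f x ^ 2 ≤ 1 := by
        rw [← sq_abs]; exact pow_le_one₀ (abs_nonneg _) (hf x)
      nlinarith [hw x]
    nlinarith [sq_nonneg m]
  -- One point carries at most the whole variance; dividing by its weight is the source of the
  -- factor `1/√(w x)`.
  have h2 : w x * (semigroup q s f x - m) ^ 2 ≤ Real.exp (-(2 * γ * s)) :=
    (Finset.single_le_sum (f := fun x => w x * (semigroup q s f x - m) ^ 2)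
      (fun y _ => mul_nonneg (hw y).le (sq_nonneg _)) (Finset.mem_univ x)).trans
      (h.trans (mul_le_of_le_one_right (Real.exp_pos _).le h1))
  rw [le_div_iff₀ (Real.sqrt_pos.2 (hw x))]
  refine abs_le_of_sq_le_sq' (a := _) (b := _) ?_ (Real.exp_pos _).le |>.2
  have e : Real.exp (-(γ * s)) ^ 2 = Real.exp (-(2 * γ * s)) := by
    rw [← Real.exp_nat_mul]
    congr 1
    push_cast
    ring
  rw [mul_pow, sq_abs, Real.sq_sqrt (hw x).le, e, mul_comm]
  exact h2

end Reversible

end Chain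

/-! ### First jump identities for exponential waiting times -/

/-- The first jump identity: if `v' = r (g - v)`, then `v s` is the mean of `v 0` in case the
exponential waiting time of rate `r` exceeds `s`, and otherwise of `g` at the remaining time. -/
lemma integral_waiting_time {r : ℝ} (hr : 0 < r) {v g : ℝ → ℝ} (hg : Continuous g)
    (hv : ∀ s, HasDerivAt v (r * (g s - v s)) s) {s : ℝ} (hs : 0 ≤ s) :
    IntegrableOn (fun u => if s ≤ Real.log (1 / u) / r then v 0
        else g (s - Real.log (1 / u) / r)) (Icc 0 1) ∧
      ∫ u in Icc (0 : ℝ) 1, (if s ≤ Real.log (1 / u) / r then v 0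
        else g (s - Real.log (1 / u) / r)) = v s := by
  set F : ℝ → ℝ := fun u => if s ≤ Real.log (1 / u) / r then v 0
        else g (s - Real.log (1 / u) / r) with hF
  set a := Real.exp (-(r * s)) with ha
  have ha0 : 0 < a := Real.exp_pos _
  have ha1 : a ≤ 1 := Real.exp_le_one_iff.2 (by nlinarith [mul_nonneg hr.le hs])
  -- The waiting time reaches `s` exactly for `u ≤ exp (-(r * s))`, so the integral splits at `a`.
  have hlog : ∀ u : ℝ, 0 < u → (s ≤ Real.log (1 / u) / r ↔ u ≤ a) := by
    intro u hu
    rw [le_div_iff₀ hr, one_div, Real.log_inv, ha, ← Real.log_le_iff_le_exp hu]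
    constructor <;> intro h <;> linarith
  have hFl : ∀ u ∈ Ioc 0 a, F u = v 0 := fun u hu => if_pos ((hlog u hu.1).2 hu.2)
  let G : ℝ → ℝ := fun u => g (s + Real.log u / r)
  have hFr : ∀ u ∈ Ioc a 1, F u = G u := by
    intro u hu
    have hu0 := ha0.trans hu.1
    rw [hF]
    dsimp only [G]
    rw [if_neg (mt (hlog u hu0).1 (not_le.2 hu.1)), one_div, Real.log_inv]
    congr 1; ring
  have hGc : ContinuousOn G (Icc a 1) := by
    refine hg.comp_continuousOn (continuousOn_const.add (ContinuousOn.div_const ?_ _))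
    exact Real.continuousOn_log.mono fun u hu => (ha0.trans_le hu.1).ne'
  have hGi : IntervalIntegrable G volume a 1 := by
    apply ContinuousOn.intervalIntegrable
    rwa [uIcc_of_le ha1]
  have i1 : IntegrableOn F (Ioc 0 a) :=
    (integrableOn_congr_fun hFl measurableSet_Ioc).2 (integrableOn_const (by simp))
  have i2 : IntegrableOn F (Ioc a 1) :=
    (integrableOn_congr_fun hFr measurableSet_Ioc).2
      ((intervalIntegrable_iff_integrableOn_Ioc_of_le ha1).1 hGi)
  have hint : ∫ u in a..1, G u = v s - a * v 0 := by
    -- The differential equation for `v` makes `u * v (s + log u / r)` an antiderivative of the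
    -- integrand: the two `v` terms cancel and `g` remains.
    have hd : ∀ u ∈ uIcc a 1, HasDerivAt (fun u => u * v (s + Real.log u / r)) (G u) u := by
      intro u hu
      rw [uIcc_of_le ha1] at hu
      have hu0 : u ≠ 0 := (ha0.trans_le hu.1).ne'
      have h1 : HasDerivAt (fun u => s + Real.log u / r) (u⁻¹ / r) u :=
        ((Real.hasDerivAt_log hu0).div_const r).const_add s
      have h2 := (hasDerivAt_id u).mul ((hv (s + Real.log u / r)).comp u h1)
      refine h2.congr_deriv ?_
      simp only [G, id, Function.comp]
      field_simp
      ring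
    rw [intervalIntegral.integral_eq_sub_of_hasDerivAt hd hGi]
    simp only [Real.log_one, zero_div, add_zero, one_mul, ha, Real.log_exp]
    congr 3
    field_simp
    ring
  have hun : Ioc (0 : ℝ) a ∪ Ioc a 1 = Ioc 0 1 := Ioc_union_Ioc_eq_Ioc ha0.le ha1
  have hI : IntegrableOn F (Ioc 0 1) := hun ▸ i1.union i2
  -- The endpoint `u = 0`, where `log (1 / u)` has the default value `0` instead of infinity, is a
  -- null set.
  refine ⟨(integrableOn_Icc_iff_integrableOn_Ioc (by simp)).2 hI, ?_⟩
  rw [integral_Icc_eq_integral_Ioc, ← hun,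
    setIntegral_union (Ioc_disjoint_Ioc_of_le le_rfl) measurableSet_Ioc i1 i2,
    setIntegral_congr_fun measurableSet_Ioc hFl, setIntegral_congr_fun measurableSet_Ioc hFr,
    ← intervalIntegral.integral_of_le ha1, hint]
  simp [ha0.le]

/-- The first jump identity for nonnegative extended reals. -/
lemma lintegral_waiting_time {r : ℝ} (hr : 0 < r) {v g : ℝ → ℝ} (hg : Continuous g)
    (hv : ∀ s, HasDerivAt v (r * (g s - v s)) s) {s : ℝ} (hs : 0 ≤ s)
    (hv0 : 0 ≤ v 0) (hg0 : ∀ s, 0 ≤ s → 0 ≤ g s) :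
    ∫⁻ u in Icc (0 : ℝ) 1, (if s ≤ Real.log (1 / u) / r then ENNReal.ofReal (v 0)
        else ENNReal.ofReal (g (s - Real.log (1 / u) / r))) = ENNReal.ofReal (v s) := by
  obtain ⟨h1, h2⟩ := integral_waiting_time hr hg hv hs
  rw [← h2, ofReal_integral_eq_lintegral_ofReal h1 (Filter.Eventually.of_forall fun u => ?_)]
  · exact lintegral_congr fun u => (apply_ite _ _ _ _).symm
  · dsimp only
    split_ifs with h
    · exact hv0
    · exact hg0 _ (by linarith)

/-! ### Outcome probabilities and call counts of the truncated algorithm -/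

section Programs

lemma prob_askAll {X A : Type} (O : X → X → ℂ) (x : X) (l : List X)
    (next : (X → ℂ) → Prog X A) :
    (askAll x l next).prob O = (next ({y | y ∈ l}.indicator (O x))).prob O := by
  classical
  induction l generalizing next with
  | nil => simp only [askAll, List.not_mem_nil, Set.ofPred_false, Set.indicator_empty]; rfl
  | cons y l ih =>
    rw [askAll, Prog.prob, ih]
    congr 2
    ext z
    by_cases h : z = y
    · subst h; simp
    · simp [h, Set.indicator_apply]

lemma maxCalls_askAll {X A : Type} (O : X → X → ℂ) (x : X) (l : List X)
    (next : (X → ℂ) → Prog X A) :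
    (askAll x l next).maxCalls O =
      l.length + (next ({y | y ∈ l}.indicator (O x))).maxCalls O := by
  classical
  induction l generalizing next with
  | nil =>
    simp only [askAll, List.not_mem_nil, Set.ofPred_false, Set.indicator_empty, List.length_nil,
      Nat.cast_zero, zero_add]
    rfl
  | cons y l ih =>
    rw [askAll, Prog.maxCalls, ih, ← add_assoc, List.length_cons, Nat.cast_add, Nat.cast_one,
      add_comm (1 : ℕ∞)]
    congr 3
    ext z
    by_cases h : z = y
    · subst h; simp
    · simp [h, Set.indicator_apply]

variable {n : ℕ}

/-- Unqueried table entries are harmless: the rate vanishes there, either because `y = x` or because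
the matrix element is zero. -/
lemma jumpRate_indicator_neighbors (H : Op n) (x : Bits n) (r : Bits n → ℂ) :
    jumpRate H x ({y | y ∈ (neighbors H x).toList}.indicator r) = jumpRate H x r := by
  ext y
  by_cases hy : y = x
  · simp [jumpRate, hy]
  · by_cases hH : H y x = 0
    · simp [jumpRate, hy, hH]
    · simp [jumpRate, hy, hH, neighbors]

lemma exitRate_nonneg (H : Op n) (x : Bits n) (r : Bits n → ℂ) : 0 ≤ exitRate H x r :=
  Finset.sum_nonneg fun y _ => jumpRate_nonneg H x r y

lemma jumpLaw_apply (H : Op n) (x : Bits n) (r : Bits n → ℂ) (h : exitRate H x r ≠ 0)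
    (y : Bits n) :
    jumpLaw H x r h y = ENNReal.ofReal (jumpRate H x r y / exitRate H x r) := by
  have h0 : 0 < exitRate H x r := lt_of_le_of_ne (exitRate_nonneg H x r) h.symm
  rw [jumpLaw, PMF.normalize_apply, tsum_fintype,
    ← ENNReal.ofReal_sum_of_nonneg fun y _ => jumpRate_nonneg H x r y, ← exitRate,
    ENNReal.ofReal_div_of_pos h0, div_eq_mul_inv]

/-- The outcome probabilities of one iteration of Gillespie's algorithm, given those of the
continuation. -/
noncomputable def stepProb (q : Bits n → Bits n → ℝ) (t τ : ℝ) (x : Bits n)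
    (p : ℝ → Bits n → ℝ≥0∞) (a : ℝ≥0∞) : ℝ≥0∞ :=
  if ∑ y, q x y = 0 then a else
    ∫⁻ u in Icc (0 : ℝ) 1, if t - τ ≤ Real.log (1 / u) / ∑ y, q x y then a
      else ∑ y, ENNReal.ofReal (q x y / ∑ y, q x y) *
        p (τ + Real.log (1 / u) / ∑ y, q x y) y

lemma prob_gillespieStep (O : Bits n → Bits n → ℂ) (H : Op n) (t τ : ℝ) (x : Bits n)
    (next : ℝ → Bits n → Prog (Bits n) (Option (Bits n))) (b : Option (Bits n)) :
    (gillespieStep H t τ x next).prob O b =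
      stepProb (fun x y => jumpRate H x (O x) y) t τ x (fun τ y => (next τ y).prob O b)
        (Set.indicator {some x} 1 b) := by
  have hj := fun y => congrFun (jumpRate_indicator_neighbors H x (O x)) y
  rw [gillespieStep, prob_askAll, stepProb]
  generalize ({y | y ∈ (neighbors H x).toList}.indicator (O x)) = r at hj ⊢
  simp only [← hj, ← exitRate.eq_def]
  by_cases h : exitRate H x r = 0
  · rw [dif_pos h, if_pos h, Prog.prob]
  · rw [dif_neg h, if_neg h, Prog.prob]
    refine lintegral_congr fun u => ?_
    by_cases hu : t ≤ τ + Real.log (1 / u) / exitRate H x r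
    · rw [if_pos hu, if_pos (by linarith), Prog.prob]
    · rw [if_neg hu, if_neg (by intro h; apply hu; linarith), Prog.prob]
      dsimp only
      rw [tsum_fintype]
      exact Finset.sum_congr rfl fun y _ => by rw [jumpLaw_apply]

section StepProb

variable {q : Bits n → Bits n → ℝ} {t : ℝ} {x : Bits n}

lemma measurable_stepProb_integrand {p : ℝ → Bits n → ℝ≥0∞} (hp : ∀ y, Measurable fun τ => p τ y)
    (a : ℝ≥0∞) :
    Measurable fun z : ℝ × ℝ => if t - z.1 ≤ Real.log (1 / z.2) / ∑ y, q x y then a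
      else ∑ y, ENNReal.ofReal (q x y / ∑ y, q x y) *
        p (z.1 + Real.log (1 / z.2) / ∑ y, q x y) y := by
  have hl : Measurable fun z : ℝ × ℝ => Real.log (1 / z.2) / ∑ y, q x y :=
    (Real.measurable_log.comp (measurable_const.div measurable_snd)).div_const _
  refine Measurable.ite (measurableSet_le (measurable_const.sub measurable_fst) hl)
    measurable_const ?_
  exact Finset.measurable_fun_sum _ fun y _ =>
    ((hp y).comp (measurable_fst.add hl)).const_mul _

/-- Measurability in the starting time is carried through the recursion to exchange sum and integral
in `sum_stepProb`; the comparison inequalities use only monotonicity. -/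
lemma measurable_stepProb {p : ℝ → Bits n → ℝ≥0∞} (hp : ∀ y, Measurable fun τ => p τ y)
    (a : ℝ≥0∞) : Measurable fun τ => stepProb q t τ x p a := by
  unfold stepProb
  by_cases h : ∑ y, q x y = 0
  · simp only [if_pos h, measurable_const]
  · simp only [if_neg h]
    exact (measurable_stepProb_integrand hp a).lintegral_prod_right'

lemma sum_ofReal_jumpLaw (hq : ∀ x y, 0 ≤ q x y) (h : ∑ y, q x y ≠ 0) :
    ∑ y, ENNReal.ofReal (q x y / ∑ y, q x y) = 1 := by
  have h0 : 0 ≤ ∑ y, q x y := Finset.sum_nonneg fun y _ => hq x y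
  rw [← ENNReal.ofReal_sum_of_nonneg fun y _ => div_nonneg (hq x y) h0, ← Finset.sum_div,
    div_self h, ENNReal.ofReal_one]

lemma sum_stepProb {B : Type*} [Fintype B] (hq : ∀ x y, 0 ≤ q x y) {p : B → ℝ → Bits n → ℝ≥0∞}
    (hp : ∀ b y, Measurable fun τ => p b τ y) (hp1 : ∀ τ y, ∑ b, p b τ y = 1)
    {a : B → ℝ≥0∞} (ha : ∑ b, a b = 1) (τ : ℝ) :
    ∑ b, stepProb q t τ x (p b) (a b) = 1 := by
  unfold stepProb
  by_cases h : ∑ y, q x y = 0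
  · simp only [if_pos h, ha]
  · simp only [if_neg h]
    have hm : ∀ b, Measurable fun u : ℝ => if t - τ ≤ Real.log (1 / u) / ∑ y, q x y then a b
        else ∑ y, ENNReal.ofReal (q x y / ∑ y, q x y) *
          p b (τ + Real.log (1 / u) / ∑ y, q x y) y := fun b =>
      (measurable_stepProb_integrand (q := q) (t := t) (x := x) (hp b) (a b)).comp
        (measurable_prodMk_left (x := τ))
    rw [← lintegral_finsetSum _ fun b _ => hm b]
    have : ∀ u : ℝ, ∑ b, (if t - τ ≤ Real.log (1 / u) / ∑ y, q x y then a b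
        else ∑ y, ENNReal.ofReal (q x y / ∑ y, q x y) *
          p b (τ + Real.log (1 / u) / ∑ y, q x y) y) = 1 := by
      intro u
      split_ifs
      · exact ha
      · rw [Finset.sum_comm]
        simp only [← Finset.mul_sum, hp1, mul_one]
        exact sum_ofReal_jumpLaw hq h
    calc _ = ∫⁻ _ in Icc (0 : ℝ) 1, (1 : ℝ≥0∞) := lintegral_congr this
      _ = 1 := by simp

/-- The backward equation at `x` reads `v' = r (g - v)`, with `g` the semigroup averaged over the
jump law. The first jump identity then writes the right side as the same integral as the left, with
a larger continuation. -/
lemma stepProb_le_semigroup (hq : ∀ x y, 0 ≤ q x y) {f : Bits n → ℝ} (hf : 0 ≤ f)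
    {p : ℝ → Bits n → ℝ≥0∞}
    (hp : ∀ τ ≤ t, ∀ y, p τ y ≤ ENNReal.ofReal (semigroup q (t - τ) f y)) {τ : ℝ} (hτ : τ ≤ t) :
    stepProb q t τ x p (ENNReal.ofReal (f x)) ≤ ENNReal.ofReal (semigroup q (t - τ) f x) := by
  set r := ∑ y, q x y with hr
  have hr0 : 0 ≤ r := Finset.sum_nonneg fun y _ => hq x y
  rw [stepProb, ← hr]
  by_cases h : r = 0
  · rw [if_pos h]
    have hz : ∀ y, q x y = 0 := fun y =>
      (Finset.sum_eq_zero_iff_of_nonneg fun y _ => hq x y).1 h y (Finset.mem_univ y)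
    -- At an absorbing state the semigroup is constant in time.
    have hd : ∀ s, HasDerivAt (fun s => semigroup q s f x) 0 s := fun s =>
      (hasDerivAt_semigroup_apply q f x s).congr_deriv (by simp [generator_apply, hz])
    have := is_const_of_deriv_eq_zero (fun s => (hd s).differentiableAt)
      (fun s => (hd s).deriv) (t - τ) 0
    simp [this, semigroup_zero]
  · rw [if_neg h]
    have hrp : 0 < r := lt_of_le_of_ne hr0 (Ne.symm h)
    rw [← lintegral_waiting_time (v := fun s => semigroup q s f x)
      (g := fun s => ∑ y, q x y / r * semigroup q s f y) hrp
      (continuous_finsetSum _ fun y _ => (continuous_semigroup_apply q f y).const_mul _)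
      (fun s => (hasDerivAt_semigroup_apply q f x s).congr_deriv ?_) (sub_nonneg.2 hτ)
      (semigroup_nonneg hq hf le_rfl x)
      (fun s hs => Finset.sum_nonneg fun y _ =>
        mul_nonneg (div_nonneg (hq x y) hr0) (semigroup_nonneg hq hf hs y))]
    · refine lintegral_mono fun u => ?_
      dsimp only
      split_ifs with hu
      · simp [semigroup_zero]
      · have hu' : τ + Real.log (1 / u) / r ≤ t := by linarith
        rw [ENNReal.ofReal_sum_of_nonneg fun y _ => mul_nonneg (div_nonneg (hq x y) hr0)
          (semigroup_nonneg hq hf (by linarith) y)]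
        refine Finset.sum_le_sum fun y _ => ?_
        rw [ENNReal.ofReal_mul (div_nonneg (hq x y) hr0)]
        gcongr
        refine (hp _ hu' y).trans (le_of_eq ?_)
        rw [sub_sub]
    · rw [generator_apply_eq, ← hr, mul_sub, Finset.mul_sum]
      congr 1
      refine Finset.sum_congr rfl fun y _ => ?_
      field_simp

/-- This is the inductive step of Markov's inequality: after a first jump, `(N + 1) p ≤ N p + 1`,
and the added one pays for the jump just made. -/
lemma stepProb_le_expectedJumps (hq : ∀ x y, 0 ≤ q x y) {N : ℕ} {p : ℝ → Bits n → ℝ≥0∞}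
    (hp1 : ∀ τ y, p τ y ≤ 1)
    (hp : ∀ τ ≤ t, ∀ y, N * p τ y ≤ ENNReal.ofReal (expectedJumps q (t - τ) y))
    {τ : ℝ} (hτ : τ ≤ t) :
    (N + 1 : ℕ) * stepProb q t τ x p 0 ≤ ENNReal.ofReal (expectedJumps q (t - τ) x) := by
  set r := ∑ y, q x y with hr
  have hr0 : 0 ≤ r := Finset.sum_nonneg fun y _ => hq x y
  rw [stepProb, ← hr]
  by_cases h : r = 0
  · simp [if_pos h]
  · rw [if_neg h, ← lintegral_const_mul' _ _ (ENNReal.natCast_ne_top _)]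
    have hrp : 0 < r := lt_of_le_of_ne hr0 (Ne.symm h)
    rw [← lintegral_waiting_time (v := fun s => expectedJumps q s x)
      (g := fun s => ∑ y, q x y / r * (expectedJumps q s y + 1)) hrp
      (continuous_finsetSum _ fun y _ =>
        ((continuous_expectedJumps_apply q y).add continuous_const).const_mul _)
      (fun s => (hasDerivAt_expectedJumps_apply q x s).congr_deriv ?_) (sub_nonneg.2 hτ)
      (expectedJumps_nonneg hq le_rfl x)
      (fun s hs => Finset.sum_nonneg fun y _ =>
        mul_nonneg (div_nonneg (hq x y) hr0) (add_nonneg (expectedJumps_nonneg hq hs y) one_pos.le))]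
    · refine lintegral_mono fun u => ?_
      dsimp only
      split_ifs with hu
      · simp
      · have hu' : τ + Real.log (1 / u) / r ≤ t := by linarith
        have hs : 0 ≤ t - τ - Real.log (1 / u) / r := by linarith
        rw [ENNReal.ofReal_sum_of_nonneg fun y _ => mul_nonneg (div_nonneg (hq x y) hr0)
          (add_nonneg (expectedJumps_nonneg hq hs y) one_pos.le), Finset.mul_sum]
        refine Finset.sum_le_sum fun y _ => ?_
        rw [ENNReal.ofReal_mul (div_nonneg (hq x y) hr0), mul_left_comm,
          ENNReal.ofReal_add (expectedJumps_nonneg hq hs y) one_pos.le, ENNReal.ofReal_one,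
          Nat.cast_add, Nat.cast_one, add_mul, one_mul, sub_sub]
        gcongr
        · exact hp _ hu' y
        · exact hp1 _ y
    · rw [generator_apply_eq, ← hr, mul_sub, Finset.mul_sum]
      have : ∑ y, r * (q x y / r * (expectedJumps q s y + 1)) =
          ∑ y, q x y * expectedJumps q s y + r := by
        rw [hr, ← Finset.sum_add_distrib, ← hr]
        refine Finset.sum_congr rfl fun y _ => ?_
        field_simp
      rw [this]
      ring

end StepProb

section Truncated

variable (O : Bits n → Bits n → ℂ) (H : Op n) (t : ℝ)

lemma measurable_prob_truncatedGillespie (M : ℕ) (b : Option (Bits n)) (x : Bits n) :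
    Measurable fun τ => (truncatedGillespie H t M τ x).prob O b := by
  induction M generalizing x with
  | zero =>
    simp only [truncatedGillespie, prob_gillespieStep]
    exact measurable_stepProb (fun y => measurable_const) _
  | succ M ih =>
    simp only [truncatedGillespie, prob_gillespieStep]
    exact measurable_stepProb ih _

lemma sum_prob_ret (a : Option (Bits n)) :
    ∑ b, (Prog.ret (X := Bits n) a).prob O b = 1 := by
  simp [Prog.prob, Set.indicator_apply]

lemma sum_prob_truncatedGillespie (M : ℕ) (τ : ℝ) (x : Bits n) :
    ∑ b, (truncatedGillespie H t M τ x).prob O b = 1 := by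
  induction M generalizing τ x with
  | zero =>
    simp only [truncatedGillespie, prob_gillespieStep]
    exact sum_stepProb (p := fun b _ _ => (Prog.ret none).prob O b)
      (fun x y => jumpRate_nonneg H x _ y) (fun b y => measurable_const)
      (fun τ y => sum_prob_ret O none) (sum_prob_ret O (some x)) τ
  | succ M ih =>
    simp only [truncatedGillespie, prob_gillespieStep]
    exact sum_stepProb (fun x y => jumpRate_nonneg H x _ y)
      (fun b y => measurable_prob_truncatedGillespie O H t M b y)
      (fun τ y => ih τ y) (sum_prob_ret O (some x)) τ

/-- The truncated algorithm outputs `y` with at most the transition probability of the chain. -/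
lemma prob_some_le_semigroup (M : ℕ) {τ : ℝ} (hτ : τ ≤ t) (x y : Bits n) :
    (truncatedGillespie H t M τ x).prob O (some y) ≤
      ENNReal.ofReal (semigroup (fun x y => jumpRate H x (O x) y) (t - τ) (Pi.single y 1) x) := by
  have hf : (0 : Bits n → ℝ) ≤ Pi.single y 1 := Pi.single_nonneg.2 zero_le_one
  have ha : ∀ x : Bits n, ({some x} : Set (Option (Bits n))).indicator
      (1 : Option (Bits n) → ℝ≥0∞) (some y) = ENNReal.ofReal ((Pi.single y 1 : Bits n → ℝ) x) := by
    intro x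
    by_cases h : x = y
    · subst h; simp
    · simp [Ne.symm h, h]
  induction M generalizing τ x with
  | zero =>
    simp only [truncatedGillespie, prob_gillespieStep, ha]
    -- Here the continuation is an error, so it never outputs a string.
    refine stepProb_le_semigroup (fun x y => jumpRate_nonneg H x (O x) y) hf (fun τ _ y => ?_) hτ
    simp [Prog.prob]
  | succ M ih =>
    simp only [truncatedGillespie, prob_gillespieStep, ha]
    exact stepProb_le_semigroup (fun x y => jumpRate_nonneg H x _ y) hf
      (fun τ hτ y => ih hτ y) hτ

/-- Markov's inequality for the number of jumps of the chain. -/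
lemma prob_none_le_expectedJumps (M : ℕ) {τ : ℝ} (hτ : τ ≤ t) (x : Bits n) :
    (M + 1 : ℕ) * (truncatedGillespie H t M τ x).prob O none ≤
      ENNReal.ofReal (expectedJumps (fun x y => jumpRate H x (O x) y) (t - τ) x) := by
  have ha : ∀ x : Bits n, ({some x} : Set (Option (Bits n))).indicator
      (1 : Option (Bits n) → ℝ≥0∞) none = 0 := by
    simp
  induction M generalizing τ x with
  | zero =>
    simp only [truncatedGillespie, prob_gillespieStep, ha]
    -- The base case has `N = 0`: the immediate error has probability one, but it is multiplied by
    -- zero.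
    refine stepProb_le_expectedJumps (fun x y => jumpRate_nonneg H x (O x) y) (fun τ y => ?_)
      (fun τ _ y => ?_) hτ
    · simp [Prog.prob]
    · simp
  | succ M ih =>
    simp only [truncatedGillespie, prob_gillespieStep, ha]
    refine stepProb_le_expectedJumps (fun x y => jumpRate_nonneg H x (O x) y) (fun τ y => ?_)
      (fun τ hτ y => ih hτ y) hτ
    rw [← sum_prob_truncatedGillespie O H t M τ y]
    exact Finset.single_le_sum (f := fun b => (truncatedGillespie H t M τ y).prob O b)
      (fun _ _ => zero_le) (Finset.mem_univ none)

lemma maxCalls_gillespieStep_le {τ : ℝ} {x : Bits n}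
    {next : ℝ → Bits n → Prog (Bits n) (Option (Bits n))} {K : ℕ∞}
    (hK : ∀ τ y, (next τ y).maxCalls O ≤ K) :
    (gillespieStep H t τ x next).maxCalls O ≤ (neighbors H x).card + K := by
  classical
  rw [gillespieStep, maxCalls_askAll, Finset.length_toList]
  gcongr
  split_ifs
  · exact zero_le
  · refine iSup_le fun u => ?_
    dsimp only
    split_ifs
    · exact zero_le
    · exact iSup_le fun y => hK _ y

/-- A cutoff of `M` jumps allows `M + 1` iterations, since rates are also computed in the last
state. -/
lemma maxCalls_truncatedGillespie_le {d : ℕ} (hd : ∀ x, (neighbors H x).card ≤ d) (M : ℕ)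
    (τ : ℝ) (x : Bits n) :
    (truncatedGillespie H t M τ x).maxCalls O ≤ ((M + 1) * d : ℕ) := by
  induction M generalizing τ x with
  | zero =>
    refine (maxCalls_gillespieStep_le O H t (next := fun _ _ => .ret none) (K := 0)
      fun _ _ => le_rfl).trans ?_
    simpa using hd x
  | succ M ih =>
    refine (maxCalls_gillespieStep_le O H t ih).trans ?_
    rw [← Nat.cast_add, Nat.cast_le]
    linarith [hd x]

end Truncated

end Programs

/-! ### From the Hamiltonian to the chain: locality, gap, stationary jump rate -/

section Hamiltonian

/-- A lower bound for the eigenvalues of a symmetric operator bounds its quadratic form. -/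
lemma mul_norm_sq_le_of_le_eigenvalue {E : Type*} [NormedAddCommGroup E] [InnerProductSpace ℂ E]
    [FiniteDimensional ℂ E] {T : E →ₗ[ℂ] E} (hT : T.IsSymmetric) {c : ℝ}
    (h : ∀ (μ : ℝ) (v : E), v ≠ 0 → T v = (μ : ℂ) • v → c ≤ μ) (x : E) :
    c * ‖x‖ ^ 2 ≤ (inner ℂ (T x) x).re := by
  by_cases hx : x = 0
  · simp [hx]
  have : Nontrivial E := ⟨x, 0, hx⟩
  -- In finite dimension the infimum of the Rayleigh quotient is itself an eigenvalue.
  obtain ⟨v, hv⟩ := (hT.hasEigenvalue_iInf_of_finiteDimensional).exists_hasEigenvector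
  have h1 := h _ v hv.2 hv.apply_eq_smul
  have hb : BddBelow (range fun x : {x : E // x ≠ 0} =>
      RCLike.re (inner ℂ (T x) (x : E)) / ‖(x : E)‖ ^ 2) := by
    refine ⟨-‖LinearMap.toContinuousLinearMap T‖, ?_⟩
    rintro _ ⟨y, rfl⟩
    exact (abs_le.1 ((LinearMap.toContinuousLinearMap T).rayleighQuotient_le_norm (y : E))).1
  have h2 := h1.trans (ciInf_le hb ⟨x, hx⟩)
  rw [le_div_iff₀ (by positivity)] at h2
  exact h2

variable {n : ℕ} {H : Op n} {ψ : Bits n → ℂ} {γ : ℝ}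

lemma IsLocalHamiltonian.isHermitian {k : ℕ} (h : IsLocalHamiltonian k H) : H.IsHermitian := by
  obtain ⟨m, h, rfl, hh⟩ := h
  rw [Matrix.IsHermitian, Matrix.conjTranspose_sum]
  exact Finset.sum_congr rfl fun a _ => (hh a).1

/-- A `k`-local Hamiltonian connects every basis state to at most `n ^ k` others. -/
lemma IsLocalHamiltonian.card_neighbors_le {k : ℕ} (h : IsLocalHamiltonian k H) (x : Bits n) :
    (neighbors H x).card ≤ n ^ k := by
  classical
  obtain ⟨m, h, rfl, hh⟩ := h
  -- Positions are given as `k`-tuples with repetition allowed, so that `n ^ k` tuples cover all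
  -- sets of between one and `k` flipped bits.
  let flip : (Fin k → Fin n) → Bits n := fun v i => if i ∈ Set.range v then !(x i) else x i
  have hsub : neighbors (∑ a, h a) x ⊆ Finset.univ.image flip := by
    intro y hy
    simp only [neighbors, Finset.mem_filter, Finset.mem_univ, true_and] at hy
    obtain ⟨hyx, hy⟩ := hy
    rw [Matrix.sum_apply] at hy
    obtain ⟨a, -, ha⟩ := Finset.exists_ne_zero_of_sum_ne_zero hy
    obtain ⟨-, -, S, hS, B, hB⟩ := hh a
    have hD : ∀ i, y i ≠ x i → i ∈ S := fun i hi => by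
      by_contra hiS
      exact ha ((hB y x).2 ⟨i, hiS, hi⟩)
    let D : Finset (Fin n) := Finset.univ.filter fun i => y i ≠ x i
    have hDk : D.card ≤ k := (Finset.card_le_card fun i hi => hD i (by simpa [D] using hi)).trans hS
    obtain ⟨i, hi⟩ := Function.ne_iff.1 hyx
    -- Nonemptiness, from `y ≠ x`, is what allows a `k`-tuple to enumerate all of `D`.
    have : Nonempty D := ⟨⟨i, by simpa [D] using hi⟩⟩
    let e : D → Fin k := fun i => Fin.castLE hDk (D.equivFin i)
    have he : Function.Injective e := (Fin.castLE_injective hDk).comp D.equivFin.injective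
    obtain ⟨g, hg⟩ : ∃ g : Fin k → D, Function.Surjective g :=
      ⟨Function.invFun e, Function.invFun_surjective he⟩
    have hr : Set.range (fun j => (g j : Fin n)) = D := by
      rw [Set.range_comp' Subtype.val g, hg.range_eq]
      simp
    refine Finset.mem_image.2 ⟨fun j => (g j : Fin n), Finset.mem_univ _, ?_⟩
    ext i
    simp only [flip, hr, D, Finset.coe_filter, Finset.mem_univ, true_and, Set.mem_ofPred_eq]
    by_cases h : y i = x i
    · simp [h]
    · simp only [ne_eq, h, not_false_eq_true, if_true]
      cases hy : y i <;> cases hx : x i <;> simp_all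
  calc (neighbors (∑ a, h a) x).card ≤ (Finset.univ.image flip).card := Finset.card_le_card hsub
    _ ≤ (Finset.univ : Finset (Fin k → Fin n)).card := Finset.card_image_le
    _ = n ^ k := by simp

lemma norm_apply_le_opNorm (A : Op n) (x y : Bits n) : ‖A x y‖ ≤ opNorm A := by
  have h1 := (Matrix.toEuclideanCLM (n := Bits n) (𝕜 := ℂ) A).le_opNorm
    (WithLp.toLp 2 (Pi.single y 1))
  have h2 : ‖(WithLp.toLp 2 (Pi.single y 1) : EuclideanSpace ℂ (Bits n))‖ = 1 := by
    simp
  rw [Matrix.toEuclideanCLM_toLp, Matrix.mulVec_single_one, h2, mul_one] at h1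
  exact (PiLp.norm_apply_le (p := 2) (WithLp.toLp 2 (A.col y) : EuclideanSpace ℂ (Bits n)) x).trans h1

lemma abs_le_opNorm_of_mulVec_eq {A : Op n} {φ : Bits n → ℂ} (hφ : φ ≠ 0) {μ : ℝ}
    (h : A *ᵥ φ = (μ : ℂ) • φ) : |μ| ≤ opNorm A := by
  have h1 := (Matrix.toEuclideanCLM (n := Bits n) (𝕜 := ℂ) A).le_opNorm (WithLp.toLp 2 φ)
  have h0 : 0 < ‖(WithLp.toLp 2 φ : EuclideanSpace ℂ (Bits n))‖ :=
    norm_pos_iff.2 (by simpa using hφ)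
  rw [Matrix.toEuclideanCLM_toLp, h, WithLp.toLp_smul, norm_smul] at h1
  simpa [opNorm] using le_of_mul_le_mul_right h1 h0

/-- The gap is a difference of two eigenvalues, each at most the norm in absolute value. This later
absorbs the one extra iteration into the call bound. -/
lemma IsGroundState.gap_le (hψ : IsGroundState H ψ γ) : γ ≤ 2 * opNorm H := by
  obtain ⟨h1, -, E, hE, ⟨φ, hφ, -, hEφ⟩, -⟩ := hψ
  have hψ0 : ψ ≠ 0 := by rintro rfl; simp at h1
  have a := abs_le.1 (abs_le_opNorm_of_mulVec_eq hψ0 hE)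
  have b := abs_le.1 (abs_le_opNorm_of_mulVec_eq hφ hEφ)
  linarith [a.1, b.2]

/-- With no qubits the space is one-dimensional, leaving no excited state to define the gap. -/
lemma IsGroundState.one_le (hψ : IsGroundState H ψ γ) : 1 ≤ n := by
  obtain ⟨h1, -, E, -, ⟨φ, hφ, hort, -⟩, -⟩ := hψ
  rw [Nat.one_le_iff_ne_zero]
  rintro rfl
  obtain ⟨x, hx⟩ := Function.ne_iff.1 hφ
  rw [Fintype.sum_subsingleton _ x] at h1
  rw [dotProduct, Fintype.sum_subsingleton _ x, Pi.star_apply, mul_eq_zero, star_eq_zero] at hort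
  rw [hort.resolve_right hx] at h1
  simp at h1

/-- The gap bounds the quadratic form of `H` on the orthogonal complement of the ground state. -/
lemma gap_mul_le_quadForm (hH : H.IsHermitian) {c : ℝ} {E : ℝ} (hE : H *ᵥ ψ = (E : ℂ) • ψ)
    (hc : ∀ (μ : ℝ) (φ : Bits n → ℂ), φ ≠ 0 → star ψ ⬝ᵥ φ = 0 → H *ᵥ φ = (μ : ℂ) • φ → c ≤ μ)
    {φ : Bits n → ℂ} (hφ : star ψ ⬝ᵥ φ = 0) :
    c * ∑ x, ‖φ x‖ ^ 2 ≤ (∑ y, ∑ x, star (φ y) * (H y x * φ x)).re := by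
  let T := Matrix.toEuclideanLin H
  have hT : T.IsSymmetric := Matrix.isSymmetric_toEuclideanLin_iff.2 hH
  let Ψ : EuclideanSpace ℂ (Bits n) := WithLp.toLp 2 ψ
  let V : Submodule ℂ (EuclideanSpace ℂ (Bits n)) := (ℂ ∙ Ψ)ᗮ
  have hmem : ∀ v : EuclideanSpace ℂ (Bits n), v ∈ V ↔ star ψ ⬝ᵥ v.ofLp = 0 := by
    intro v
    rw [Submodule.mem_orthogonal_singleton_iff_inner_right, EuclideanSpace.inner_eq_star_dotProduct,
      dotProduct_comm]
  have hTΨ : T Ψ = (E : ℂ) • Ψ := congrArg (WithLp.toLp 2) hE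
  -- Symmetry and the eigenvector `ψ` make its orthogonal complement invariant, so the Rayleigh
  -- bound applies to the restricted operator.
  have hinv : ∀ v ∈ V, T v ∈ V := by
    intro v hv
    rw [Submodule.mem_orthogonal_singleton_iff_inner_right] at hv ⊢
    rw [← hT, hTΨ, inner_smul_left, hv, mul_zero]
  have key := mul_norm_sq_le_of_le_eigenvalue (hT.restrict_invariant hinv) (c := c)
    (fun μ v hv hTv => hc μ (v : EuclideanSpace ℂ (Bits n)).ofLp
      (fun h => hv (Subtype.ext ((WithLp.ofLp_eq_zero 2).1 h))) ((hmem v).1 v.2) ?_)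
    ⟨WithLp.toLp 2 φ, (hmem _).2 hφ⟩
  · have e1 : ‖(⟨WithLp.toLp 2 φ, (hmem _).2 hφ⟩ : V)‖ ^ 2 = ∑ x, ‖φ x‖ ^ 2 := by
      rw [Submodule.coe_norm, EuclideanSpace.norm_sq_eq]
    rw [e1, Submodule.coe_inner] at key
    refine key.trans (le_of_eq ?_)
    rw [LinearMap.coe_restrict_apply]
    change (inner ℂ (T (WithLp.toLp 2 φ)) (WithLp.toLp 2 φ)).re = _
    rw [hT, EuclideanSpace.inner_eq_star_dotProduct, dotProduct_comm]
    congr 1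
    change star φ ⬝ᵥ H *ᵥ φ = _
    simp only [dotProduct, Matrix.mulVec, Finset.mul_sum, Pi.star_apply]
  · have := congrArg (fun v : V => (v : EuclideanSpace ℂ (Bits n)).ofLp) hTv
    exact this

/-- The stationary flow `π(x) ⟨y|G|x⟩` is the positive part of `-Re (⟨ψ|y⟩⟨y|H|x⟩⟨x|ψ⟩)`. -/
lemma groundDist_mul_jumpRate (hψ : ∀ x, 0 < groundDist ψ x) (x y : Bits n) :
    groundDist ψ x * jumpRate H x (amplitudeRatio ψ x) y =
      if y = x then 0 else max 0 (-(star (ψ y) * (H y x * ψ x)).re) := by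
  unfold jumpRate
  split_ifs
  · simp
  · rw [mul_max_of_nonneg _ _ (hψ x).le, mul_zero, mul_neg, groundDist, ← Complex.re_ofReal_mul]
    congr 3
    have h0 : ψ x ≠ 0 := by
      intro h
      have := hψ x
      simp [groundDist, h] at this
    have h0' : (starRingEnd ℂ) (ψ x) ≠ 0 := by simpa using h0
    rw [amplitudeRatio, Complex.ofReal_pow, ← Complex.conj_mul']
    simp only [star_div₀, RCLike.star_def]
    field_simp

lemma re_star_mul_comm (hH : H.IsHermitian) (x y : Bits n) :
    (star (ψ y) * (H y x * ψ x)).re = (star (ψ x) * (H x y * ψ y)).re := by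
  rw [← hH.apply x y, ← Complex.conj_re]
  congr 1
  simp only [RCLike.star_def, map_mul, Complex.conj_conj]
  ring

lemma groundDist_reversible (hH : H.IsHermitian) (hψ : ∀ x, 0 < groundDist ψ x) (x y : Bits n) :
    groundDist ψ x * jumpRate H x (amplitudeRatio ψ x) y =
      groundDist ψ y * jumpRate H y (amplitudeRatio ψ y) x := by
  rw [groundDist_mul_jumpRate hψ, groundDist_mul_jumpRate hψ, re_star_mul_comm hH]
  simp only [eq_comm]

/-- The spectral gap of the Hamiltonian gives a Poincaré inequality for the chain. -/
lemma IsGroundState.poincare (hH : H.IsHermitian) (hg : IsGroundState H ψ γ)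
    (hψ : ∀ x, 0 < groundDist ψ x) (f : Bits n → ℝ) (hf : ∑ x, groundDist ψ x * f x = 0) :
    γ * ∑ x, groundDist ψ x * f x ^ 2 ≤
      (∑ x, ∑ y, groundDist ψ x * jumpRate H x (amplitudeRatio ψ x) y * (f x - f y) ^ 2) / 2 := by
  obtain ⟨-, -, E, hE, -, hlow⟩ := hg
  set A : Bits n → Bits n → ℝ := fun x y => (star (ψ y) * (H y x * ψ x)).re with hA
  have hAs : ∀ x y, A x y = A y x := fun x y => re_star_mul_comm hH x y
  have hsq : ∀ x, star (ψ x) * ψ x = ((groundDist ψ x : ℝ) : ℂ) := fun x => by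
    rw [groundDist, RCLike.star_def, Complex.conj_mul', Complex.ofReal_pow]
  have hort : star ψ ⬝ᵥ (fun x => (f x : ℂ) * ψ x) = 0 := by
    have : star ψ ⬝ᵥ (fun x => (f x : ℂ) * ψ x) = ((∑ x, groundDist ψ x * f x : ℝ) : ℂ) := by
      rw [Complex.ofReal_sum]
      refine Finset.sum_congr rfl fun x _ => ?_
      rw [Complex.ofReal_mul, ← hsq, Pi.star_apply]
      ring
    rw [this, hf, Complex.ofReal_zero]
  have key := gap_mul_le_quadForm hH hE (c := E + γ)
    (fun μ φ h0 h1 h2 => hlow ⟨φ, h0, h1, h2⟩) hort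
  have e1 : ∑ x, ‖(f x : ℂ) * ψ x‖ ^ 2 = ∑ x, groundDist ψ x * f x ^ 2 := by
    refine Finset.sum_congr rfl fun x _ => ?_
    rw [norm_mul, mul_pow, Complex.norm_real, Real.norm_eq_abs, sq_abs, groundDist, mul_comm]
  have e2 : (∑ y, ∑ x, star ((f y : ℂ) * ψ y) * (H y x * ((f x : ℂ) * ψ x))).re =
      ∑ y, ∑ x, A x y * (f x * f y) := by
    simp only [Complex.re_sum]
    refine Finset.sum_congr rfl fun y _ => Finset.sum_congr rfl fun x _ => ?_
    rw [hA, mul_comm _ (f x * f y), ← Complex.re_ofReal_mul]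
    congr 1
    simp only [star_mul', RCLike.star_def, Complex.conj_ofReal, Complex.ofReal_mul]
    ring
  -- Pairing the eigenvalue equation at `y` with `conj ψ(y)` gives these sums; they convert the `E`
  -- term into sums against `A`.
  have e3 : ∀ y, ∑ x, A x y = E * groundDist ψ y := by
    intro y
    have h := congrArg (fun z => (star (ψ y) * z).re) (congrFun hE y)
    simp only [Matrix.mulVec, dotProduct, Finset.mul_sum, Complex.re_sum, Pi.smul_apply,
      smul_eq_mul] at h
    rw [hA, h, mul_left_comm, hsq, ← Complex.ofReal_mul, Complex.ofReal_re]
  have e4 : E * ∑ x, groundDist ψ x * f x ^ 2 = ∑ y, ∑ x, A x y * f y ^ 2 := by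
    simp only [← Finset.sum_mul, e3, Finset.mul_sum]
    exact Finset.sum_congr rfl fun x _ => by ring
  have e5 : ∑ y, ∑ x, A x y * f y ^ 2 = ∑ y, ∑ x, A x y * f x ^ 2 := by
    rw [Finset.sum_comm]
    exact Finset.sum_congr rfl fun x _ => Finset.sum_congr rfl fun y _ => by rw [hAs]
  have e6 : ∑ y, ∑ x, A x y * f y ^ 2 + ∑ y, ∑ x, A x y * f x ^ 2 -
      2 * ∑ y, ∑ x, A x y * (f x * f y) = ∑ y, ∑ x, A x y * (f x - f y) ^ 2 := by
    simp only [Finset.mul_sum, ← Finset.sum_add_distrib, ← Finset.sum_sub_distrib]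
    exact Finset.sum_congr rfl fun x _ => Finset.sum_congr rfl fun y _ => by ring
  -- Terms with positive `A` are dropped here; diagonal terms vanish because of `f x - f x`.
  have e7 : -∑ y, ∑ x, A x y * (f x - f y) ^ 2 ≤
      ∑ x, ∑ y, groundDist ψ x * jumpRate H x (amplitudeRatio ψ x) y * (f x - f y) ^ 2 := by
    rw [Finset.sum_comm]
    simp only [← Finset.sum_neg_distrib]
    refine Finset.sum_le_sum fun x _ => Finset.sum_le_sum fun y _ => ?_
    rw [groundDist_mul_jumpRate hψ, ← neg_mul]
    split_ifs with h
    · simp [h]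
    · exact mul_le_mul_of_nonneg_right (le_max_right _ _) (sq_nonneg _)
  rw [e1, e2] at key
  linarith

/-- The stationary expectation of the total jump rate. -/
lemma sum_groundDist_mul_exitRate_le {d : ℕ} (hH : H.IsHermitian)
    (hd : ∀ x, (neighbors H x).card ≤ d) (hψ : ∀ x, 0 < groundDist ψ x)
    (h1 : ∑ x, groundDist ψ x = 1) :
    ∑ x, groundDist ψ x * ∑ y, jumpRate H x (amplitudeRatio ψ x) y ≤ d * opNorm H := by
  classical
  have hN : 0 ≤ opNorm H := norm_nonneg _
  let a : Bits n → Bits n → ℝ := fun x y => if y ∈ neighbors H x then 1 else 0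
  have ha : ∀ x y, a x y = a y x := by
    intro x y
    have : H y x = 0 ↔ H x y = 0 := by rw [← hH.apply x y]; simp
    simp only [a, neighbors, Finset.mem_filter, Finset.mem_univ, true_and, ne_eq, this,
      eq_comm (a := x)]
  have hs : ∀ x, ∑ y, a x y ≤ d := by
    intro x
    simp only [a, Finset.sum_ite_mem, Finset.univ_inter, Finset.sum_const, nsmul_eq_mul, mul_one]
    exact_mod_cast hd x
  -- The flow is at most `‖H‖ |ψ x| |ψ y|`; the arithmetic-geometric mean inequality splits it into
  -- two halves with equal totals.
  have hb : ∀ x y, groundDist ψ x * jumpRate H x (amplitudeRatio ψ x) y ≤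
      opNorm H * ((groundDist ψ x * a x y + groundDist ψ y * a y x) / 2) := by
    intro x y
    rw [groundDist_mul_jumpRate hψ, ← ha x y, ← add_mul]
    have hw : ∀ x, 0 ≤ groundDist ψ x := fun x => (hψ x).le
    have ha0 : 0 ≤ a x y := by simp only [a]; split_ifs <;> norm_num
    have hr : 0 ≤ opNorm H * ((groundDist ψ x + groundDist ψ y) * a x y / 2) :=
      mul_nonneg hN (div_nonneg (mul_nonneg (add_nonneg (hw x) (hw y)) ha0) two_pos.le)
    split_ifs with hyx
    · exact hr
    · refine max_le hr ?_
      by_cases hxy : H y x = 0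
      · simpa [hxy] using hr
      · have : a x y = 1 := by simp [a, neighbors, hyx, hxy]
        rw [this, mul_one]
        refine (neg_le_abs _).trans ((Complex.abs_re_le_norm _).trans ?_)
        rw [norm_mul, norm_mul, norm_star, mul_left_comm]
        refine mul_le_mul (norm_apply_le_opNorm H y x) ?_ (by positivity) hN
        rw [groundDist, groundDist]
        nlinarith [sq_nonneg (‖ψ x‖ - ‖ψ y‖)]
  have hc : ∑ x, ∑ y, groundDist ψ x * a x y ≤ d := by
    calc ∑ x, ∑ y, groundDist ψ x * a x y = ∑ x, groundDist ψ x * ∑ y, a x y := by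
          simp only [Finset.mul_sum]
      _ ≤ ∑ x, groundDist ψ x * d :=
          Finset.sum_le_sum fun x _ => mul_le_mul_of_nonneg_left (hs x) (hψ x).le
      _ = d := by rw [← Finset.sum_mul, h1, one_mul]
  calc ∑ x, groundDist ψ x * ∑ y, jumpRate H x (amplitudeRatio ψ x) y
      = ∑ x, ∑ y, groundDist ψ x * jumpRate H x (amplitudeRatio ψ x) y := by
        simp only [Finset.mul_sum]
    _ ≤ ∑ x, ∑ y, opNorm H * ((groundDist ψ x * a x y + groundDist ψ y * a y x) / 2) :=
        Finset.sum_le_sum fun x _ => Finset.sum_le_sum fun y _ => hb x y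
    _ = opNorm H * ((∑ x, ∑ y, groundDist ψ x * a x y +
          ∑ x, ∑ y, groundDist ψ y * a y x) / 2) := by
        rw [← Finset.sum_add_distrib, Finset.sum_div, Finset.mul_sum]
        refine Finset.sum_congr rfl fun x _ => ?_
        rw [← Finset.sum_add_distrib, Finset.sum_div, Finset.mul_sum]
    _ = opNorm H * ∑ x, ∑ y, groundDist ψ x * a x y := by
        rw [Finset.sum_comm (f := fun x y => groundDist ψ y * a y x)]
        ring
    _ ≤ d * opNorm H := by
        rw [mul_comm]
        exact mul_le_mul_of_nonneg_right hc hN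

lemma minProb_le (ψ : Bits n → ℂ) (x : Bits n) : minProb ψ ≤ groundDist ψ x :=
  ciInf_le (Set.finite_range _).bddBelow x

lemma minProb_pos (hψ : ∀ x, 0 < groundDist ψ x) : 0 < minProb ψ := by
  obtain ⟨x, hx⟩ := exists_eq_ciInf_of_finite (f := groundDist ψ)
  rw [minProb, ← hx]
  exact hψ x

lemma minProb_le_half (hn : 1 ≤ n) (h1 : ∑ x, groundDist ψ x = 1) : minProb ψ ≤ 1 / 2 := by
  have hne : (fun _ => true : Bits n) ≠ fun _ => false := fun h => by
    simpa using congrFun h ⟨0, hn⟩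
  have h2 : groundDist ψ (fun _ => true) + groundDist ψ (fun _ => false) ≤ 1 := by
    rw [← h1, ← Finset.sum_pair hne]
    exact Finset.sum_le_sum_of_subset_of_nonneg (Finset.subset_univ _)
      fun x _ _ => by unfold groundDist; positivity
  linarith [minProb_le ψ fun _ => true, minProb_le ψ fun _ => false]

end Hamiltonian

/-! ### Error budget and cost of the sampler -/

section Sampler

/-- Conditioning on an event of probability `1 - e` costs at most `e` in total variation. -/
lemma tvDist_div_sum_le {X : Type} [Fintype X] {a P w : X → ℝ} {e : ℝ} (ha : ∀ x, 0 ≤ a x)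
    (haP : ∀ x, a x ≤ P x) (hP : ∑ x, P x = 1) (he : ∑ x, a x = 1 - e) (he0 : 0 ≤ e)
    (he1 : e < 1) : tvDist (fun x => a x / ∑ z, a z) w ≤ e + tvDist P w := by
  have hs : 0 < ∑ z, a z := by rw [he]; linarith
  -- The first two differences are nonnegative and each sums to `e`; the half in the total variation
  -- distance leaves a single `e`.
  have h : ∀ x, |a x / ∑ z, a z - w x| ≤ (a x / ∑ z, a z - a x) + (P x - a x) + |P x - w x| := by
    intro x
    have h1 : a x ≤ a x / ∑ z, a z := by
      rw [le_div_iff₀ hs]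
      exact mul_le_of_le_one_right (ha x) (by linarith)
    have h2 := haP x
    have h3 := neg_abs_le (P x - w x)
    have h4 := le_abs_self (P x - w x)
    rw [abs_le]
    constructor <;> linarith
  have h5 := Finset.sum_le_sum fun x (_ : x ∈ Finset.univ) => h x
  simp only [Finset.sum_add_distrib, Finset.sum_sub_distrib, ← Finset.sum_div] at h5
  rw [div_self hs.ne', hP, he] at h5
  unfold tvDist
  rw [he]
  linarith

lemma sum_mul_apply_single {X : Type*} [Fintype X] [DecidableEq X] (L : (X → ℝ) →L[ℝ] (X → ℝ))
    (f : X → ℝ) (x : X) : ∑ y, f y * L (Pi.single y 1) x = L f x := by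
  have : f = ∑ y, f y • (Pi.single y 1 : X → ℝ) := by
    ext z
    simp [Finset.sum_apply, Pi.single_apply]
  conv_rhs => rw [this]
  simp [map_sum, Finset.sum_apply]

/-- Convergence of a reversible chain with a Poincaré inequality in total variation. -/
lemma semigroup_single_mixing {X : Type} [Fintype X] [DecidableEq X] {q : X → X → ℝ} {w : X → ℝ}
    {γ : ℝ} (hrev : ∀ x y, w x * q x y = w y * q y x)
    (hw : ∀ x, 0 < w x) (hw1 : ∑ x, w x = 1)
    (hgap : ∀ f : X → ℝ, ∑ x, w x * f x = 0 →
      γ * ∑ x, w x * f x ^ 2 ≤ (∑ x, ∑ y, w x * q x y * (f x - f y) ^ 2) / 2)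
    {s : ℝ} (hs : 0 ≤ s) (x : X) :
    ∑ y, semigroup q s (Pi.single y 1) x = 1 ∧
      tvDist (fun y => semigroup q s (Pi.single y 1) x) w ≤
        Real.exp (-(γ * s)) / √(w x) / 2 := by
  constructor
  -- Conservation of mass: a constant has variance zero and so stays constant.
  · have h := variance_semigroup_le hrev hw1 hgap (fun _ => 1) hs
    simp only [mul_one, hw1, sub_self, ne_eq, OfNat.ofNat_ne_zero, not_false_eq_true, zero_pow,
      mul_zero, Finset.sum_const_zero] at h
    have h1 := (Finset.single_le_sum (f := fun x => w x * (semigroup q s (fun _ => 1) x - 1) ^ 2)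
      (fun y _ => mul_nonneg (hw y).le (sq_nonneg _)) (Finset.mem_univ x)).trans h
    have h2 : (semigroup q s (fun _ => 1) x - 1) ^ 2 ≤ 0 :=
      nonpos_of_mul_nonpos_right h1 (hw x)
    have h3 := sum_mul_apply_single (semigroup q s) (fun _ => 1) x
    simp only [one_mul] at h3
    rw [h3]
    exact sub_eq_zero.1 (pow_eq_zero_iff two_ne_zero |>.1 (le_antisymm h2 (sq_nonneg _)))
  -- The sign of the discrepancy is the test function that turns the pointwise bound into the `ℓ¹`
  -- distance.
  · set f : X → ℝ := fun y => ((SignType.sign (semigroup q s (Pi.single y 1) x - w y) : SignType) : ℝ)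
      with hfdef
    have hf : ∀ y, |f y| ≤ 1 := fun y => by
      simp only [hfdef]
      cases SignType.sign (semigroup q s (Pi.single y 1) x - w y) <;> simp
    have h := abs_semigroup_sub_le hrev hw hw1 hgap hf hs x
    rw [← sum_mul_apply_single, ← Finset.sum_sub_distrib] at h
    unfold tvDist
    refine div_le_div_of_nonneg_right (le_trans (le_of_eq ?_) ((le_abs_self _).trans h)) two_pos.le
    refine Finset.sum_congr rfl fun y _ => ?_
    rw [mul_comm (w y), ← mul_sub, hfdef, sign_mul_self]

variable {n k : ℕ} {H : Op n} {ψ : Bits n → ℂ} {γ ε : ℝ}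

lemma sum_prob_sampler (O : Bits n → Bits n → ℂ) (pmin : ℝ) (x : Bits n) :
    ∑ y, (sampler k H γ pmin ε x).prob O (some y) + (sampler k H γ pmin ε x).prob O none = 1 := by
  have h := sum_prob_truncatedGillespie O H (evolutionTime γ pmin ε)
    ⌊flipCutoff k H ε (evolutionTime γ pmin ε)⌋₊ 0 x
  rw [Fintype.sum_option, add_comm] at h
  exact h

lemma evolutionTime_nonneg {pmin : ℝ} (hγ : 0 < γ) (hp : 0 < pmin) (hp1 : pmin ≤ 1 / 2)
    (hε : 0 < ε) (hε1 : ε ≤ 1) : 0 ≤ evolutionTime γ pmin ε := by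
  refine div_nonneg (Real.log_nonneg ?_) hγ.le
  have h1 : √pmin ≤ 1 := Real.sqrt_le_one.2 (by linarith)
  have h0 : 0 < √pmin := Real.sqrt_pos.2 hp
  rw [le_div_iff₀ (mul_pos hε h0)]
  nlinarith

lemma exp_neg_mul_evolutionTime {pmin : ℝ} (hγ : 0 < γ) (hp : 0 < pmin) (hε : 0 < ε) :
    Real.exp (-(γ * evolutionTime γ pmin ε)) = ε * √pmin / 2 := by
  have h0 : 0 < √pmin := Real.sqrt_pos.2 hp
  rw [evolutionTime, mul_div_cancel₀ _ hγ.ne', ← Real.log_inv, Real.exp_log (by positivity), inv_div]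

/-- Since `π* ≤ 1/2`, the `log 2` is absorbed into `-log π*`, which raises its coefficient from
`1/2` to `3/2`. -/
lemma evolutionTime_mul_le {pmin : ℝ} (hγ : 0 < γ) (hp : 0 < pmin) (hp1 : pmin ≤ 1 / 2)
    (hε : 0 < ε) (hε1 : ε ≤ 1) :
    evolutionTime γ pmin ε * γ ≤ 3 / 2 * Real.log (1 / (ε * pmin)) ∧
      1 / 2 ≤ Real.log (1 / (ε * pmin)) := by
  have h0 : 0 < √pmin := Real.sqrt_pos.2 hp
  have hl : Real.log pmin ≤ -Real.log 2 := by
    rw [← Real.log_inv]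
    exact Real.log_le_log hp (by linarith)
  have hle : Real.log ε ≤ 0 := Real.log_nonpos hε.le hε1
  have h2 := Real.log_two_gt_d9
  rw [evolutionTime, div_mul_cancel₀ _ hγ.ne', Real.log_div two_ne_zero (by positivity),
    Real.log_mul hε.ne' h0.ne', Real.log_sqrt hp.le, one_div, Real.log_inv,
    Real.log_mul hε.ne' hp.ne']
  constructor <;> linarith

lemma exists_maxCalls_sampler_le (hH : IsLocalHamiltonian k H) (hg : IsGroundState H ψ γ)
    (hψ : ∀ x, 0 < groundDist ψ x) (hε : 0 < ε) (hε1 : ε ≤ 1) (O : Bits n → Bits n → ℂ)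
    (x : Bits n) :
    ∃ N : ℕ, (sampler k H γ (minProb ψ) ε x).maxCalls O ≤ N ∧
      (N : ℝ) ≤ 10 * ε⁻¹ * (n : ℝ) ^ (2 * k) * opNorm H / γ *
        Real.log (1 / (ε * minProb ψ)) := by
  have hγ : 0 < γ := hg.2.1
  have hp := minProb_pos hψ
  have hp1 := minProb_le_half hg.one_le hg.1
  have hN : 0 ≤ opNorm H := norm_nonneg _
  have ht := evolutionTime_nonneg hγ hp hp1 hε hε1
  obtain ⟨h1, h2⟩ := evolutionTime_mul_le hγ hp hp1 hε hε1
  refine ⟨_, maxCalls_truncatedGillespie_le O H _ hH.card_neighbors_le _ _ _, ?_⟩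
  set t := evolutionTime γ (minProb ψ) ε
  set L := Real.log (1 / (ε * minProb ψ))
  have hcut : (⌊flipCutoff k H ε t⌋₊ : ℝ) ≤ flipCutoff k H ε t :=
    Nat.floor_le (by unfold flipCutoff; positivity)
  have hnk : (1 : ℝ) ≤ (n : ℝ) ^ k := one_le_pow₀ (by exact_mod_cast hg.one_le)
  have hn2k : (n : ℝ) ^ (2 * k) = (n : ℝ) ^ k * (n : ℝ) ^ k := by rw [two_mul, pow_add]
  set d := (n : ℝ) ^ k
  have hratio : 1 ≤ 2 * (opNorm H / γ) := by
    rw [← mul_div_assoc, one_le_div hγ]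
    exact hg.gap_le
  have hεinv : 1 ≤ ε⁻¹ := (one_le_inv₀ hε).2 hε1
  -- With `L` the logarithm, the jumps cost `4K(tγ) ≤ 6KL` and the extra iteration `d ≤ 2K ≤ 4KL`;
  -- hence the constant 10.
  set K := ε⁻¹ * (d * d) * (opNorm H / γ) with hK
  have hK0 : 0 ≤ K := by positivity
  have hdK : d ≤ 2 * K := by
    have : d ≤ ε⁻¹ * (d * d) := by nlinarith [mul_le_mul hεinv hnk zero_le_one (by positivity)]
    rw [hK]
    nlinarith
  have hmain : flipCutoff k H ε t * d = 4 * K * (t * γ) := by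
    rw [flipCutoff, hK]
    field_simp
    ring
  have hgoal : 10 * ε⁻¹ * (n : ℝ) ^ (2 * k) * opNorm H / γ * L = 10 * (K * L) := by
    rw [hn2k, hK]
    ring
  rw [hgoal]
  push_cast
  have hstep : ((⌊flipCutoff k H ε t⌋₊ : ℝ) + 1) * d ≤ flipCutoff k H ε t * d + d := by
    rw [add_mul, one_mul]
    gcongr
  have h3 : K * (t * γ) ≤ K * (3 / 2 * L) := mul_le_mul_of_nonneg_left h1 hK0
  have h4 : K * (1 / 2) ≤ K * L := mul_le_mul_of_nonneg_left h2 hK0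
  linarith

/-- If every start were bad, averaging Markov's inequality over `π` would contradict the stationary
jump count. The strict inequality comes from the cutoff being below its floor plus one. -/
lemma goodStarts_sampler_nonempty (hH : IsLocalHamiltonian k H) (hg : IsGroundState H ψ γ)
    (hψ : ∀ x, 0 < groundDist ψ x) (hε : 0 < ε) (hε1 : ε ≤ 1) :
    (goodStarts (amplitudeRatio ψ) (sampler k H γ (minProb ψ) ε) ε).Nonempty := by
  have hw1 : ∑ x, groundDist ψ x = 1 := hg.1
  have ht := evolutionTime_nonneg hg.2.1 (minProb_pos hψ) (minProb_le_half hg.one_le hw1) hε hε1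
  by_contra hemp
  rw [Set.not_nonempty_iff_eq_empty, Set.eq_empty_iff_forall_notMem] at hemp
  set t := evolutionTime γ (minProb ψ) ε with htdef
  set M := ⌊flipCutoff k H ε t⌋₊ with hM
  set q : Bits n → Bits n → ℝ := fun x y => jumpRate H x (amplitudeRatio ψ x) y with hq
  have hlow : ∀ x, (M + 1 : ℝ) * (ε / 4) ≤ expectedJumps q t x := by
    intro x
    have h1 := prob_none_le_expectedJumps (amplitudeRatio ψ) H t M ht x
    have h2 : ENNReal.ofReal (ε / 4) ≤
        (truncatedGillespie H t M 0 x).prob (amplitudeRatio ψ) none := (not_le.1 (hemp x)).le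
    rw [sub_zero] at h1
    have h3 : ENNReal.ofReal ((M + 1 : ℝ) * (ε / 4)) ≤ ENNReal.ofReal (expectedJumps q t x) := by
      refine le_trans ?_ h1
      rw [ENNReal.ofReal_mul (by positivity)]
      refine mul_le_mul' (le_of_eq ?_) h2
      rw [← Nat.cast_add_one, ENNReal.ofReal_natCast]
    exact (ENNReal.ofReal_le_ofReal_iff
      (expectedJumps_nonneg (fun x y => jumpRate_nonneg H x _ y) ht x)).1 h3
  have h4 : (M + 1 : ℝ) * (ε / 4) ≤ t * ∑ x, groundDist ψ x * ∑ y, q x y := by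
    rw [← sum_mul_expectedJumps (groundDist_reversible hH.isHermitian hψ)]
    calc (M + 1 : ℝ) * (ε / 4) = ∑ x, groundDist ψ x * ((M + 1 : ℝ) * (ε / 4)) := by
          rw [← Finset.sum_mul, hw1, one_mul]
      _ ≤ _ := Finset.sum_le_sum fun x _ => mul_le_mul_of_nonneg_left (hlow x) (hψ x).le
  have h5 := mul_le_mul_of_nonneg_left
    (sum_groundDist_mul_exitRate_le hH.isHermitian hH.card_neighbors_le hψ hw1) ht
  have h6 : flipCutoff k H ε t < M + 1 := Nat.lt_floor_add_one _
  have h7 : flipCutoff k H ε t * (ε / 4) = t * ((n ^ k : ℕ) * opNorm H) := by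
    rw [flipCutoff]
    push_cast
    field_simp
  have h8 := mul_lt_mul_of_pos_right h6 (show 0 < ε / 4 by linarith)
  linarith

lemma tvDist_condOutput_sampler_le (hH : IsLocalHamiltonian k H) (hg : IsGroundState H ψ γ)
    (hψ : ∀ x, 0 < groundDist ψ x) (hε : 0 < ε) (hε1 : ε ≤ 1) {x : Bits n}
    (hx : x ∈ goodStarts (amplitudeRatio ψ) (sampler k H γ (minProb ψ) ε) ε) :
    tvDist (condOutput (amplitudeRatio ψ) (sampler k H γ (minProb ψ) ε x)) (groundDist ψ) ≤ ε := by
  have hw1 : ∑ x, groundDist ψ x = 1 := hg.1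
  have hp := minProb_pos hψ
  have ht := evolutionTime_nonneg hg.2.1 hp (minProb_le_half hg.one_le hw1) hε hε1
  set t := evolutionTime γ (minProb ψ) ε with htdef
  set q : Bits n → Bits n → ℝ := fun x y => jumpRate H x (amplitudeRatio ψ x) y with hq
  obtain ⟨hP1, hmix⟩ := semigroup_single_mixing (groundDist_reversible hH.isHermitian hψ) hψ hw1
    (hg.poincare hH.isHermitian hψ) ht x
  set p := (sampler k H γ (minProb ψ) ε x).prob (amplitudeRatio ψ) with hpdef
  have hsum : ∑ y, p (some y) + p none = 1 := sum_prob_sampler _ _ _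
  have hnone : p none ≤ ENNReal.ofReal (ε / 4) := hx
  have hfin : ∀ b, p b ≠ ∞ := by
    have h1 : p none ≤ 1 := hsum ▸ le_add_self
    have h2 : ∀ y, p (some y) ≤ 1 := fun y => hsum ▸
      (Finset.single_le_sum (f := fun y => p (some y)) (fun _ _ => zero_le)
        (Finset.mem_univ y)).trans le_self_add
    rintro (_ | y)
    · exact ne_top_of_le_ne_top ENNReal.one_ne_top h1
    · exact ne_top_of_le_ne_top ENNReal.one_ne_top (h2 y)
  have hsumR : ∑ y, (p (some y)).toReal = 1 - (p none).toReal := by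
    have := congrArg ENNReal.toReal hsum
    rw [ENNReal.toReal_add (ENNReal.sum_ne_top.2 fun y _ => hfin _) (hfin _),
      ENNReal.toReal_sum fun y _ => hfin _, ENNReal.toReal_one] at this
    linarith
  have hnoneR : (p none).toReal ≤ ε / 4 :=
    ENNReal.toReal_le_of_le_ofReal (by linarith) hnone
  have hle : ∀ y, (p (some y)).toReal ≤ semigroup q t (Pi.single y 1) x := fun y => by
    refine ENNReal.toReal_le_of_le_ofReal
      (semigroup_nonneg (fun x y => jumpRate_nonneg H x _ y)
        (Pi.single_nonneg.2 zero_le_one) ht x) ?_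
    have := prob_some_le_semigroup (amplitudeRatio ψ) H t ⌊flipCutoff k H ε t⌋₊ ht x y
    rwa [sub_zero] at this
  have hcond : condOutput (amplitudeRatio ψ) (sampler k H γ (minProb ψ) ε x) =
      fun y => (p (some y)).toReal / ∑ z, (p (some z)).toReal := by
    ext y
    rw [condOutput, tsum_fintype, ENNReal.toReal_div, ENNReal.toReal_sum fun z _ => hfin _]
  have htv := tvDist_div_sum_le (w := groundDist ψ) (fun y => ENNReal.toReal_nonneg) hle hP1 hsumR
    ENNReal.toReal_nonneg (by linarith)
  -- The `√π*` in the evolution time compensates the worst starting weight. Halved, this is a mixing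
  -- error of `ε/4`, so with conditioning the total is at most `ε/2`.
  have hexp : Real.exp (-(γ * t)) / √(groundDist ψ x) ≤ ε / 2 := by
    rw [exp_neg_mul_evolutionTime hg.2.1 hp hε, div_le_iff₀ (Real.sqrt_pos.2 (hψ x))]
    have := Real.sqrt_le_sqrt (minProb_le ψ x)
    nlinarith
  rw [hcond]
  linarith

end Sampler

end GroundStateSampling

open GroundStateSampling in
theorem theorem2 :
    ∃ C : ℝ, 0 < C ∧
      ∀ (n k : ℕ) (H : Op n) (ψ : Bits n → ℂ) (γ : ℝ),
        IsLocalHamiltonian k H → IsGroundState H ψ γ → (∀ x, 0 < groundDist ψ x) →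
        ∀ ε : ℝ, 0 < ε → ε ≤ 1 →
          -- the outcome probabilities, a string or an error, add up to one
          (∀ x, (∑ y, (sampler k H γ (minProb ψ) ε x).prob (amplitudeRatio ψ) (some y)) +
              (sampler k H γ (minProb ψ) ε x).prob (amplitudeRatio ψ) none = 1) ∧
          -- the number of calls to the subroutine
          (∀ x, ∃ N : ℕ,
            (sampler k H γ (minProb ψ) ε x).maxCalls (amplitudeRatio ψ) ≤ N ∧
              (N : ℝ) ≤ C * ε⁻¹ * (n : ℝ) ^ (2 * k) * opNorm H / γ *
                Real.log (1 / (ε * minProb ψ))) ∧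
          -- the set of good starting states is nonempty
          (goodStarts (amplitudeRatio ψ) (sampler k H γ (minProb ψ) ε) ε).Nonempty ∧
          -- the output from a good starting state, conditioned on no error
          ∀ x ∈ goodStarts (amplitudeRatio ψ) (sampler k H γ (minProb ψ) ε) ε,
            tvDist (condOutput (amplitudeRatio ψ) (sampler k H γ (minProb ψ) ε x))
              (groundDist ψ) ≤ ε := by
  refine ⟨10, by norm_num, fun n k H ψ γ hH hg hψ ε hε hε1 => ⟨fun x => ?_, fun x => ?_, ?_, ?_⟩⟩
  · exact sum_prob_sampler _ _ _
  · exact exists_maxCalls_sampler_le hH hg hψ hε hε1 _ x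
  · exact goodStarts_sampler_nonempty hH hg hψ hε hε1
  · exact fun x hx => tvDist_condOutput_sampler_le hH hg hψ hε hε1 hx
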